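/- Let $\kappa,m>0$ and $a,Q,P\in\mathbb R$ with $E_-:=1-\kappa^2a^2>0$, and put $U=r^2+a^2\cos^2\theta$, $\Delta_-(\theta)=1-\kappa^2a^2\cos^2\theta$, $\Delta_-(r)=(r^2+a^2)(1+\kappa^2r^2)-2mr+Q^2+P^2$. The Kerr–Newman–AdS metric in Boyer–Lindquist coordinates $(t,r,\theta,\varphi)$ is $$g=-\tfrac{\Delta_-(r)}{U}\Big(dt-\tfrac{a\sin^2\theta}{E_-}d\varphi\Big)^2+\tfrac{U}{\Delta_-(r)}dr^2+\tfrac{U}{\Delta_-(\theta)}d\theta^2+\tfrac{\Delta_-(\theta)\sin^2\theta}{U}\Big(a\,dt-\tfrac{r^2+a^2}{E_-}d\varphi\Big)^2,$$ with electromagnetic potential $A=-\frac{Qr}{U}\big(dt-\frac{a\sin^2\theta}{E_-}d\varphi\big)-\frac{P\cos\theta}{U}\big(a\,dt-\frac{r^2+a^2}{E_-}d\varphi\big)$. Suppose that the spacetime is extreme: $\Delta_-(r)$ has a double root $r_e>0$ and its two other roots are not real. Write $\Delta_-(r)=(r-r_e)^2B_-(r)$. Let $e_0=\frac{(r^2+a^2)\partial_t+aE_-\partial_\varphi}{\sqrt{U\Delta_-(r)}}$,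 $e_1=\sqrt{\frac{\Delta_-(r)}{U}}\,\partial_r$, $e_2=\sqrt{\frac{\Delta_-(\theta)}{U}}\,\partial_\theta$, $e_3=-\frac{1}{\sqrt{U\Delta_-(\theta)}}\big(a\sin\theta\,\partial_t+\frac{E_-}{\sin\theta}\partial_\varphi\big)$, a $g$-orthonormal frame on the exterior region $r>r_e$, $0<\theta<\pi$, with dual coframe $e^\alpha$. The coframe acts on $\mathbb C^4$ by Clifford multiplication ($v\cdot v=-\langle v,v\rangle$) through the matrices $$e^0=\begin{pmatrix}0&-\sigma^0\\-\sigma^0&0\end{pmatrix},\quad e^i=\begin{pmatrix}0&\sigma^i\\-\sigma^i&0\end{pmatrix}\ (i=1,2,3),$$ $$\sigma^0=\begin{pmatrix}1&0\\0&1\end{pmatrix},\ \sigma^1=\begin{pmatrix}-1&0\\0&1\end{pmatrix},\ \sigma^2=\begin{pmatrix}0&1\\1&0\end{pmatrix},\ \sigma^3=\begin{pmatrix}0&i\\-i&0\end{pmatrix}.$$ Let $\mathscr D=e^\alpha\cdot\nabla_{e_\alpha}$ be the Dirac operator, where $\nabla_X\Psi=X(\Psi)-\frac12\sum_{\alpha<\beta}\omega_{\alpha\beta}(X)\,e^\alpha\cdot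 e^\beta\cdot\Psi$ and $\omega_{\alpha\beta}(X)=\langle e_\alpha,\nabla_Xe_\beta\rangle$ are the Levi-Civita connection forms. Let $\lambda,\omega\in\mathbb R$, $k\in\mathbb Z$, and let $\Psi$ be a solution, not identically zero, of $$\big(\mathscr D+ie^\alpha A(e_\alpha)+i\lambda\big)\Psi=0$$ on the exterior region which is differentiable there and, in the above frame, locally bounded up to the axis $\theta\in\{0,\pi\}$ (i.e. bounded on the part with $0<\theta<\pi$ of every compact subset of $\{r>r_e,\ 0\le\theta\le\pi\}$, as every continuous spinor field is), and which is of the time-periodic form $\Psi=S_-^{-1}\Phi$, $$\Phi=e^{-i(\omega t+(k+\frac12)\varphi)}\begin{pmatrix}X_-(r)Y_-(\theta)\\X_+(r)Y_+(\theta)\\X_+(r)Y_-(\theta)\\X_-(r)Y_+(\theta)\end{pmatrix},$$ $$S_-=\Delta_-(r)^{\frac14}\,\mathrm{diag}\big((r+ia\cos\theta)^{\frac12},(r+ia\cos\theta)^{\frac12},(r-ia\cos\theta)^{\frac12},(r-ia\cos\theta)^{\frac12}\big).$$ Suppose that $\Psi\in L^p(M_{(r_e,+\infty)})$ for some $p\in[1,+\infty)$,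 where $M_{(r_e,+\infty)}$ is a slice $\{t=\mathrm{const},\ r>r_e\}$ with its induced Riemannian volume and $|\Psi|$ is the Hermitian norm on $\mathbb C^4$. Then there is exactly one constant $\eta_+\in\mathbb C$, and it is real, such that the separated equations hold: for $r>r_e$, $$X_+'-\tfrac{i}{\Delta_-(r)}K X_+-\tfrac{i\lambda r+\eta_+}{\sqrt{\Delta_-(r)}}X_-=0,\qquad X_-'+\tfrac{i}{\Delta_-(r)}K X_-+\tfrac{i\lambda r-\eta_+}{\sqrt{\Delta_-(r)}}X_+=0,$$ with $K=\omega(r^2+a^2)+Qr+(k+\frac12)E_-a$, and for $0<\theta<\pi$, $$a\lambda\cos\theta\,Y_-+\sqrt{\Delta_-(\theta)}\,L_{\theta+}Y_+=\eta_+Y_-,\qquad -\sqrt{\Delta_-(\theta)}\,L_{\theta-}Y_--a\lambda\cos\theta\,Y_+=\eta_+Y_+,$$ with $L_{\theta\pm}=\partial_\theta\mp\frac{1}{\Delta_-(\theta)}\big(\omega a\sin\theta+\frac{(k+\frac12)E_-}{\sin\theta}-P\cot\theta\big)+\frac12\big(\cot\theta+\frac{\kappa^2a^2\sin\theta\cos\theta}{\Delta_-(\theta)}\big)$.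 Moreover, with $$\zeta_1=B_-(r_e),\qquad \zeta_2=B_-'(r_e),\qquad \zeta_3=\frac{\omega a^2+(k+\frac12)E_-a}{-r_e}+\omega r_e,$$ at least one of the following holds: (i) $(\eta_+^2+\lambda^2r_e^2)\zeta_1-\zeta_3^2\ge0$; (ii) $\zeta_2\zeta_3-2\omega\zeta_1=0$; (iii) $r_e\zeta_2\zeta_3+2\zeta_1\zeta_3=0$. If $\eta_+=0$, then at least one of (i) and (iii) holds; if $\lambda=0$, then at least one of (i) and (ii) holds; and if $\lambda=\eta_+=0$, then $Q=-2\omega r_e$. -/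

import Mathlib

open MeasureTheory Polynomial
open scoped ENNReal Matrix

/-- Parameters of the Kerr-Newman-AdS spacetime: cosmological constant `-3 κ ^ 2`, mass `m`,
angular momentum parameter `a`, electric charge `Q` and magnetic charge `P`. -/
structure KNAdS where
  κ : ℝ
  m : ℝ
  a : ℝ
  Q : ℝ
  P : ℝ
  κ_pos : 0 < κ
  m_pos : 0 < m
  E_pos : 0 < 1 - κ ^ 2 * a ^ 2

namespace KNAdS

/-- Boyer-Lindquist coordinates `(t, r, θ, φ) = (x 0, x 1, x 2, x 3)`; coordinate components of
tangent vectors are listed in the same order. -/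
abbrev Coord := Fin 4 → ℝ

/-- The spinor space `ℂ⁴`. -/
abbrev Spinor := Fin 4 → ℂ

noncomputable section

variable (M : KNAdS)

/-! ### The metric and the electromagnetic potential -/

/-- `E₋ = 1 - κ² a²`. -/
def E : ℝ := 1 - M.κ ^ 2 * M.a ^ 2

/-- `U = r² + a² cos² θ`. -/
def U (r θ : ℝ) : ℝ := r ^ 2 + M.a ^ 2 * Real.cos θ ^ 2

/-- The quartic polynomial `Δ₋ = (r² + a²)(1 + κ² r²) - 2 m r + Q² + P²` in `r`. -/
def deltaPoly : ℝ[X] :=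
  (X ^ 2 + C (M.a ^ 2)) * (1 + C (M.κ ^ 2) * X ^ 2) - C (2 * M.m) * X + C (M.Q ^ 2 + M.P ^ 2)

/-- The function `Δ₋(r)`. -/
def deltaR (r : ℝ) : ℝ := M.deltaPoly.eval r

/-- `Δ₋(θ) = 1 - κ² a² cos² θ`. -/
def deltaTheta (θ : ℝ) : ℝ := 1 - M.κ ^ 2 * M.a ^ 2 * Real.cos θ ^ 2

/-- The one-form `dt - (a sin² θ / E₋) dφ` at the point `x`, applied to the vector `v`. -/
def formT (x v : Coord) : ℝ := v 0 - M.a * Real.sin (x 2) ^ 2 / M.E * v 3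

/-- The one-form `a dt - ((r² + a²) / E₋) dφ` at the point `x`, applied to the vector `v`. -/
def formPhi (x v : Coord) : ℝ := M.a * v 0 - (x 1 ^ 2 + M.a ^ 2) / M.E * v 3

/-- The Kerr-Newman-AdS metric at `x`. -/
def metric (x v w : Coord) : ℝ :=
  -(M.deltaR (x 1) / M.U (x 1) (x 2)) * (M.formT x v * M.formT x w)
    + M.U (x 1) (x 2) / M.deltaR (x 1) * (v 1 * w 1)
    + M.U (x 1) (x 2) / M.deltaTheta (x 2) * (v 2 * w 2)
    + M.deltaTheta (x 2) * Real.sin (x 2) ^ 2 / M.U (x 1) (x 2) * (M.formPhi x v * M.formPhi x w)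

/-- The electromagnetic potential one-form `A` at `x`, applied to `v`. -/
def potential (x v : Coord) : ℝ :=
  -(M.Q * x 1 / M.U (x 1) (x 2)) * M.formT x v
    - M.P * Real.cos (x 2) / M.U (x 1) (x 2) * M.formPhi x v

/-! ### Extremality and the exterior region -/

/-- The spacetime is extreme with horizon radius `re > 0`: `re` is a double root of the quartic
`Δ₋`, and the two other roots of `Δ₋` are not real. -/
def IsExtreme (re : ℝ) : Prop :=
  0 < re ∧ M.deltaPoly.rootMultiplicity re = 2 ∧ ∀ r : ℝ, M.deltaPoly.IsRoot r → r = re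

/-- The quadratic polynomial `B₋` with `Δ₋ = (r - re)² B₋` (when `re` is a double root). -/
def B (re : ℝ) : ℝ[X] := M.deltaPoly /ₘ (X - C re) ^ 2

/-- The exterior region `r > re`, off the axis. -/
def exterior (re : ℝ) : Set Coord := {x | re < x 1 ∧ 0 < x 2 ∧ x 2 < Real.pi}

/-! ### The Dirac operator -/

/-- The orthonormal frame `e₀, e₁, e₂, e₃`, in coordinate components. -/
def frame : Fin 4 → Coord → Coord :=
  ![fun x => ![(x 1 ^ 2 + M.a ^ 2) / √(M.U (x 1) (x 2) * M.deltaR (x 1)), 0, 0,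
      M.a * M.E / √(M.U (x 1) (x 2) * M.deltaR (x 1))],
    fun x => ![0, √(M.deltaR (x 1) / M.U (x 1) (x 2)), 0, 0],
    fun x => ![0, 0, √(M.deltaTheta (x 2) / M.U (x 1) (x 2)), 0],
    fun x => ![-(M.a * Real.sin (x 2)) / √(M.U (x 1) (x 2) * M.deltaTheta (x 2)), 0, 0,
      -M.E / (Real.sin (x 2) * √(M.U (x 1) (x 2) * M.deltaTheta (x 2)))]]

/-- The Levi-Civita connection coefficients `ω_{αβ}(e_γ) = ⟨e_α, ∇_{e_γ} e_β⟩` in the orthonormal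
frame, given by the Koszul formula. -/
def connection (α β γ : Fin 4) (x : Coord) : ℝ :=
  (M.metric x (VectorField.lieBracket ℝ (M.frame γ) (M.frame β) x) (M.frame α x)
    - M.metric x (VectorField.lieBracket ℝ (M.frame β) (M.frame α) x) (M.frame γ x)
    + M.metric x (VectorField.lieBracket ℝ (M.frame α) (M.frame γ) x) (M.frame β x)) / 2

/-- The matrices representing Clifford multiplication by the dual coframe `e⁰, e¹, e², e³`
(with `v · v = -⟨v, v⟩`). -/
def clifford : Fin 4 → Matrix (Fin 4) (Fin 4) ℂ :=
  ![!![0, 0, -1, 0; 0, 0, 0, -1; -1, 0, 0, 0; 0, -1, 0, 0],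
    !![0, 0, -1, 0; 0, 0, 0, 1; 1, 0, 0, 0; 0, -1, 0, 0],
    !![0, 0, 0, 1; 0, 0, 1, 0; 0, -1, 0, 0; -1, 0, 0, 0],
    !![0, 0, 0, Complex.I; 0, 0, -Complex.I, 0; 0, -Complex.I, 0, 0; Complex.I, 0, 0, 0]]

/-- The spinorial Levi-Civita derivative
`∇_{e_γ} Ψ = e_γ(Ψ) - 1/2 ∑_{α < β} ω_{αβ}(e_γ) e^α · e^β · Ψ`; since `ω_{αβ}` and `e^α · e^β`
are both antisymmetric for `α ≠ β`, it is written with the sum over all `α, β` and `1/4`. -/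
def spinDeriv (Ψ : Coord → Spinor) (γ : Fin 4) (x : Coord) : Spinor :=
  fderiv ℝ Ψ x (M.frame γ x)
    - (1 / 4 : ℂ) • ∑ α, ∑ β, (M.connection α β γ x : ℂ) • (clifford α * clifford β) *ᵥ Ψ x

/-- The charged Dirac operator `𝒟 + i e^α A(e_α)`, where `𝒟 = e^α · ∇_{e_α}`. -/
def dirac (Ψ : Coord → Spinor) (x : Coord) : Spinor :=
  ∑ α, clifford α *ᵥ
    (M.spinDeriv Ψ α x + (Complex.I * (M.potential x (M.frame α x) : ℂ)) • Ψ x)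

/-- `Ψ` is a (classical) solution of `(𝒟 + i e^α A(e_α) + i lam) Ψ = 0` in the exterior region. -/
def IsDiracSolution (re lam : ℝ) (Ψ : Coord → Spinor) : Prop :=
  ∀ x ∈ exterior re, DifferentiableAt ℝ Ψ x ∧ M.dirac Ψ x + (Complex.I * (lam : ℂ)) • Ψ x = 0

/-- `Ψ` is locally bounded in the region `r > re` up to and including the axis `θ = 0, π` of the
sphere, as is every continuous spinor field on that region expressed in the above frame. -/
def LocallyBoundedAtAxis (re : ℝ) (Ψ : Coord → Spinor) : Prop :=
  ∀ K : Set Coord, IsCompact K → K ⊆ {x | re < x 1} →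
    Bornology.IsBounded (Ψ '' (K ∩ exterior re))

/-! ### Separated spinors -/

/-- The separated spinor field `S₋⁻¹ Φ`, where
`Φ = exp (-i (ω t + (k + 1/2) φ)) (X₋ Y₋, X₊ Y₊, X₊ Y₋, X₋ Y₊)` and
`S₋ = Δ₋(r)^(1/4) diag (z^(1/2), z^(1/2), z'^(1/2), z'^(1/2))`, `z = r + i a cos θ`,
`z' = r - i a cos θ`. -/
def separated (ω : ℝ) (k : ℤ) (Xp Xm Yp Ym : ℝ → ℂ) (x : Coord) : Spinor :=
  let d : ℂ := ((M.deltaR (x 1) ^ (1 / 4 : ℝ) : ℝ) : ℂ)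
  let z : ℂ := ((x 1 : ℂ) + Complex.I * ((M.a * Real.cos (x 2) : ℝ) : ℂ)) ^ (1 / 2 : ℂ)
  let z' : ℂ := ((x 1 : ℂ) - Complex.I * ((M.a * Real.cos (x 2) : ℝ) : ℂ)) ^ (1 / 2 : ℂ)
  Complex.exp (-Complex.I * ((ω * x 0 + ((k : ℝ) + 1 / 2) * x 3 : ℝ) : ℂ)) •
    ![(d * z)⁻¹ * (Xm (x 1) * Ym (x 2)), (d * z)⁻¹ * (Xp (x 1) * Yp (x 2)),
      (d * z')⁻¹ * (Xp (x 1) * Ym (x 2)), (d * z')⁻¹ * (Xm (x 1) * Yp (x 2))]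

/-- `ω (r² + a²) + Q r + (k + 1/2) E₋ a`. -/
def radialK (ω : ℝ) (k : ℤ) (r : ℝ) : ℝ :=
  ω * (r ^ 2 + M.a ^ 2) + M.Q * r + ((k : ℝ) + 1 / 2) * M.E * M.a

/-- The radial equations on `r > re` with separation constant `η`. -/
def RadialEq (re lam ω : ℝ) (k : ℤ) (η : ℂ) (Xp Xm : ℝ → ℂ) : Prop :=
  ∀ r : ℝ, re < r →
    DifferentiableAt ℝ Xp r ∧ DifferentiableAt ℝ Xm r ∧
    deriv Xp r - Complex.I / (M.deltaR r : ℂ) * (M.radialK ω k r : ℂ) * Xp r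
      - (Complex.I * (lam : ℂ) * (r : ℂ) + η) / (√(M.deltaR r) : ℂ) * Xm r = 0 ∧
    deriv Xm r + Complex.I / (M.deltaR r : ℂ) * (M.radialK ω k r : ℂ) * Xm r
      + (Complex.I * (lam : ℂ) * (r : ℂ) - η) / (√(M.deltaR r) : ℂ) * Xp r = 0

/-- `(1 / Δ₋(θ)) (ω a sin θ + (k + 1/2) E₋ / sin θ - P cot θ)`. -/
def angularW (ω : ℝ) (k : ℤ) (θ : ℝ) : ℝ :=
  (ω * M.a * Real.sin θ + ((k : ℝ) + 1 / 2) * M.E / Real.sin θ - M.P * Real.cot θ)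
    / M.deltaTheta θ

/-- `(1 / 2) (cot θ + κ² a² sin θ cos θ / Δ₋(θ))`. -/
def angularH (θ : ℝ) : ℝ :=
  (Real.cot θ + M.κ ^ 2 * M.a ^ 2 * Real.sin θ * Real.cos θ / M.deltaTheta θ) / 2

/-- The angular equations on `0 < θ < π` with separation constant `η`. -/
def AngularEq (lam ω : ℝ) (k : ℤ) (η : ℂ) (Yp Ym : ℝ → ℂ) : Prop :=
  ∀ θ : ℝ, 0 < θ → θ < Real.pi →
    DifferentiableAt ℝ Yp θ ∧ DifferentiableAt ℝ Ym θ ∧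
    ((M.a * lam * Real.cos θ : ℝ) : ℂ) * Ym θ
      + (√(M.deltaTheta θ) : ℂ)
        * (deriv Yp θ - (M.angularW ω k θ : ℂ) * Yp θ + (M.angularH θ : ℂ) * Yp θ) = η * Ym θ ∧
    -((√(M.deltaTheta θ) : ℂ)
        * (deriv Ym θ + (M.angularW ω k θ : ℂ) * Ym θ + (M.angularH θ : ℂ) * Ym θ))
      - ((M.a * lam * Real.cos θ : ℝ) : ℂ) * Yp θ = η * Yp θ

/-- `η` is a separation constant of the separated solution given by `X₊, X₋, Y₊, Y₋`. -/
def IsSeparationConstant (re lam ω : ℝ) (k : ℤ) (Xp Xm Yp Ym : ℝ → ℂ) (η : ℂ) : Prop :=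
  M.RadialEq re lam ω k η Xp Xm ∧ M.AngularEq lam ω k η Yp Ym

/-! ### Integrability on a time slice -/

/-- The point with coordinates `(t, r, θ, φ)`, where `q = (r, θ, φ)`. -/
def slicePoint (t : ℝ) (q : ℝ × ℝ × ℝ) : Coord := ![t, q.1, q.2.1, q.2.2]

/-- The Riemannian volume density `√ det (g(∂_i, ∂_j))`, `i, j ∈ {r, θ, φ}`, of the time slice. -/
def sliceDensity (t : ℝ) (q : ℝ × ℝ × ℝ) : ℝ :=
  √(Matrix.of fun i j : Fin 3 =>
    M.metric (slicePoint t q) (Pi.single i.succ 1) (Pi.single j.succ 1)).det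

/-- The Riemannian volume measure of the part `r > re` of the time slice with time `t`, in the
coordinates `(r, θ, φ)`, `0 < θ < π`, `0 < φ < 2π`. -/
def sliceMeasure (re t : ℝ) : Measure (ℝ × ℝ × ℝ) :=
  ((volume : Measure (ℝ × ℝ × ℝ)).restrict
    (Set.Ioi re ×ˢ Set.Ioo 0 Real.pi ×ˢ Set.Ioo 0 (2 * Real.pi))).withDensity
      fun q => ENNReal.ofReal (M.sliceDensity t q)

/-- `Ψ` is in `L^p` of the time slice `{t = const, r > re}`, with the Hermitian norm on `ℂ⁴`. -/
def MemLpSlice (re t : ℝ) (p : ℝ≥0∞) (Ψ : Coord → Spinor) : Prop :=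
  MemLp (fun q => WithLp.toLp 2 (Ψ (slicePoint t q)) : ℝ × ℝ × ℝ → EuclideanSpace ℂ (Fin 4)) p
    (M.sliceMeasure re t)

/-! ### The constants of the extreme spacetime -/

/-- `ζ₁ = B₋(re)`. -/
def zeta1 (re : ℝ) : ℝ := (M.B re).eval re

/-- `ζ₂ = B₋'(re)`. -/
def zeta2 (re : ℝ) : ℝ := (derivative (M.B re)).eval re

/-- `ζ₃ = (ω a² + (k + 1/2) E₋ a) / (-re) + ω re`. -/
def zeta3 (re ω : ℝ) (k : ℤ) : ℝ :=
  (ω * M.a ^ 2 + ((k : ℝ) + 1 / 2) * M.E * M.a) / (-re) + ω * re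

/-- Condition (i). -/
def CondI (re lam ω η : ℝ) (k : ℤ) : Prop :=
  (η ^ 2 + lam ^ 2 * re ^ 2) * M.zeta1 re - M.zeta3 re ω k ^ 2 ≥ 0

/-- Condition (ii). -/
def CondII (re ω : ℝ) (k : ℤ) : Prop :=
  M.zeta2 re * M.zeta3 re ω k - 2 * ω * M.zeta1 re = 0

/-- Condition (iii). -/
def CondIII (re ω : ℝ) (k : ℤ) : Prop :=
  re * M.zeta2 re * M.zeta3 re ω k + 2 * M.zeta1 re * M.zeta3 re ω k = 0

end

end KNAdS

namespace KNAdS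

noncomputable section

variable (M : KNAdS)

/-! ### Positivity and the factorisation of `Δ₋` -/

/-! The weight `S₋` is chosen so that differentiating it cancels the spin connection, except for the
term `angularH`. Multiplied by `√U`, each row of the Dirac equation then becomes an identity between
an expression in `r` times a function of `θ` and an expression in `θ` times a function of `r`
(`separated_system`). Since `Ψ` is not identically zero, these identities define a single constant
`η` (`exists_separationConstant`). It is real because the angular operator is formally self-adjoint
and boundedness at the axis kills the boundary terms (`separationConstant_im_eq_zero`).

The rest happens at the horizon. Since `Δ₋` has a double zero, the radial system has diagonal
coefficient `K/Δ₋` and off-diagonal coefficient `(iλr + η)/√Δ₋`. Let `g` be the quotient of the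
second by the first. The form `|X₊|² + |X₋|² + 2 Im(g X₋ X̄₊)` has derivative `2 Im(g' X₋ X̄₊)`: the
singular terms cancel. If `g` is `C¹` up to `re` and `|g(re)| < 1`, the form is comparable to
`|X|²`, and Grönwall keeps `|X|²` away from zero at the horizon (`radial_lower_bound`). The slice
volume density grows like `1/(r - re)`, so the set where `|Ψ|` exceeds some positive constant has
infinite volume, which no `L^p` function with finite `p` allows (`not_memLpSlice_of_eventually_le`).
Hence `|g(re)| ≥ 1` whenever `g` extends in this way (`one_le_of_memLpSlice`).

If `K(re) ≠ 0`, then `g(re) = 0`, a contradiction; so `K(re) = 0`. Then `K = (r - re)(ζ₃ + ω(r -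
re))`, and for `ζ₃ ≠ 0` the bound `|g(re)| ≥ 1` is exactly condition (i), while for `ζ₃ = 0`
condition (i) is trivial. Thus (i) always holds and settles every alternative. For `λ = η = 0` it
forces `ζ₃ = 0`, which together with `K(re) = 0` determines `Q`. -/

lemma U_nonneg (r θ : ℝ) : 0 ≤ M.U r θ := by
  unfold U; positivity

lemma U_pos {r : ℝ} (hr : 0 < r) (θ : ℝ) : 0 < M.U r θ := by
  unfold U; positivity

lemma deltaTheta_pos (θ : ℝ) : 0 < M.deltaTheta θ := by
  have h := M.E_pos
  have h1 : Real.cos θ ^ 2 ≤ 1 := Real.cos_sq_le_one θ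
  have h2 : M.κ ^ 2 * M.a ^ 2 * Real.cos θ ^ 2 ≤ M.κ ^ 2 * M.a ^ 2 * 1 := by gcongr
  unfold deltaTheta
  linarith

lemma deltaR_eq (r : ℝ) : M.deltaR r =
    (r ^ 2 + M.a ^ 2) * (1 + M.κ ^ 2 * r ^ 2) - 2 * M.m * r + (M.Q ^ 2 + M.P ^ 2) := by
  simp [deltaR, deltaPoly]

variable {M}

/-- The value of `B₋` at `x`. -/
def quadB (M : KNAdS) (re x : ℝ) : ℝ :=
  M.κ ^ 2 * x ^ 2 + 2 * M.κ ^ 2 * re * x + (1 + M.κ ^ 2 * M.a ^ 2 + 3 * M.κ ^ 2 * re ^ 2)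

/-- The equations `Δ₋(re) = 0` and `Δ₋'(re) = 0` eliminate `Q² + P²` and `m`. The cofactor is then
read off from the three top coefficients, the cubic one being zero. -/
lemma IsExtreme.deltaR_factor {re : ℝ} (h : M.IsExtreme re) (x : ℝ) :
    M.deltaR x = (x - re) ^ 2 * M.quadB re x := by
  obtain ⟨-, h2, -⟩ := h
  have hd : (X - C re) ^ 2 ∣ M.deltaPoly := h2 ▸ pow_rootMultiplicity_dvd M.deltaPoly re
  obtain ⟨q, hq⟩ := hd
  have e0 : M.deltaPoly.eval re = 0 := by rw [hq]; simp
  have e1 : (derivative M.deltaPoly).eval re = 0 := by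
    rw [hq, derivative_mul, derivative_pow]; simp
  have e1' : (derivative M.deltaPoly).eval re =
      2 * re * (1 + M.κ ^ 2 * re ^ 2) + (re ^ 2 + M.a ^ 2) * (M.κ ^ 2 * (2 * re)) - 2 * M.m := by
    simp [deltaPoly, -map_pow]
    ring
  rw [e1'] at e1
  have e0' := M.deltaR_eq re
  rw [deltaR, e0] at e0'
  rw [deltaR_eq, quadB]
  linear_combination (x - re) * e1 - e0'

lemma quadB_pos {re x : ℝ} (hr : 0 < re) (hx : 0 ≤ x) : 0 < M.quadB re x := by
  unfold quadB; positivity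

lemma IsExtreme.deltaR_pos {re r : ℝ} (h : M.IsExtreme re) (hr : re < r) : 0 < M.deltaR r := by
  rw [h.deltaR_factor]
  exact mul_pos (pow_pos (sub_pos.2 hr) 2) (quadB_pos h.1 (h.1.trans hr).le)

lemma IsExtreme.B_eval {re : ℝ} (h : M.IsExtreme re) (x : ℝ) : (M.B re).eval x = M.quadB re x := by
  have hB : M.deltaPoly = (X - C re) ^ 2 *
      (C (M.κ ^ 2) * X ^ 2 + C (2 * M.κ ^ 2 * re) * X +
        C (1 + M.κ ^ 2 * M.a ^ 2 + 3 * M.κ ^ 2 * re ^ 2)) := by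
    refine Polynomial.funext fun y => ?_
    have := h.deltaR_factor y
    rw [deltaR] at this
    rw [this, quadB]
    simp
  rw [B, hB, mul_divByMonic_cancel_left _ ((monic_X_sub_C re).pow 2), quadB]
  simp

/-! ### The frame -/

variable (M)

/-- Every nonzero frame component is a function of `r` times a function of `θ`, divided by `√U`. The
dummy factors `1` here and in the next three lemmas fit the components to
`hasFDerivAt_mul_div_sqrt_U`. -/
lemma frame_zero : M.frame 0 = fun x =>
    ![(x 1 ^ 2 + M.a ^ 2) / √(M.deltaR (x 1)) * 1 / √(M.U (x 1) (x 2)), 0, 0,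
      M.a * M.E / √(M.deltaR (x 1)) * 1 / √(M.U (x 1) (x 2))] := by
  funext x
  simp only [frame, Matrix.cons_val_zero, Real.sqrt_mul (M.U_nonneg _ _), mul_one, div_div,
    mul_comm (√(M.deltaR (x 1)))]

lemma frame_one : M.frame 1 = fun x => ![0, √(M.deltaR (x 1)) * 1 / √(M.U (x 1) (x 2)), 0, 0] := by
  funext x
  simp [frame, Real.sqrt_div' _ (M.U_nonneg _ _)]

lemma frame_two : M.frame 2 = fun x =>
    ![0, 0, 1 * √(M.deltaTheta (x 2)) / √(M.U (x 1) (x 2)), 0] := by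
  funext x
  simp [frame, Real.sqrt_div' _ (M.U_nonneg _ _)]

lemma frame_three : M.frame 3 = fun x =>
    ![1 * (-(M.a * Real.sin (x 2)) / √(M.deltaTheta (x 2))) / √(M.U (x 1) (x 2)), 0, 0,
      1 * (-M.E / (Real.sin (x 2) * √(M.deltaTheta (x 2)))) / √(M.U (x 1) (x 2))] := by
  funext x
  simp only [frame, Matrix.cons_val, Real.sqrt_mul (M.U_nonneg _ _), one_mul, div_div]
  ring_nf

variable {M}

lemma hasFDerivAt_mul_div_sqrt_U {f g : ℝ → ℝ} {f' g' : ℝ} {x : Coord} (hx : 0 < x 1)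
    (hf : HasDerivAt f f' (x 1)) (hg : HasDerivAt g g' (x 2)) :
    HasFDerivAt (fun y : Coord => f (y 1) * g (y 2) / √(M.U (y 1) (y 2)))
      ((f' * g (x 2) / √(M.U (x 1) (x 2)) - f (x 1) * g (x 2) * x 1 / √(M.U (x 1) (x 2)) ^ 3) •
          ContinuousLinearMap.proj (R := ℝ) (φ := fun _ : Fin 4 => ℝ) 1 +
        (f (x 1) * g' / √(M.U (x 1) (x 2)) + f (x 1) * g (x 2) *
            (M.a ^ 2 * Real.cos (x 2) * Real.sin (x 2)) / √(M.U (x 1) (x 2)) ^ 3) •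
          ContinuousLinearMap.proj (R := ℝ) (φ := fun _ : Fin 4 => ℝ) 2) x := by
  have hU := M.U_pos hx (x 2)
  have p1 : HasFDerivAt (𝕜 := ℝ) (fun y : Coord => y 1) _ x := hasFDerivAt_apply 1 x
  have p2 : HasFDerivAt (𝕜 := ℝ) (fun y : Coord => y 2) _ x := hasFDerivAt_apply 2 x
  have hf' := hf.comp_hasFDerivAt x p1
  have hg' := hg.comp_hasFDerivAt x p2
  have hUf : HasFDerivAt (fun y : Coord => M.U (y 1) (y 2)) _ x :=
    (p1.pow 2).add ((((Real.hasDerivAt_cos (x 2)).comp_hasFDerivAt x p2).pow 2).const_mul (M.a ^ 2))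
  have h := (hf'.mul hg').mul ((hasDerivAt_inv (Real.sqrt_pos.2 hU).ne').comp_hasFDerivAt x
    (hUf.sqrt hU.ne'))
  refine h.congr_fderiv ?_
  ext v
  have hu := (Real.sqrt_pos.2 hU).ne'
  simp
  field_simp
  ring

lemma hasDerivAt_sqrt_deltaTheta (θ : ℝ) : HasDerivAt (fun y => √(M.deltaTheta y))
    (M.κ ^ 2 * M.a ^ 2 * Real.cos θ * Real.sin θ / √(M.deltaTheta θ)) θ := by
  have h := M.deltaTheta_pos θ
  have h1 : HasDerivAt M.deltaTheta _ θ :=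
    (((Real.hasDerivAt_cos θ).pow 2).const_mul (M.κ ^ 2 * M.a ^ 2)).const_sub 1
  refine (h1.sqrt h.ne').congr_deriv ?_
  have := (Real.sqrt_pos.2 h).ne'
  field_simp
  simp
  ring

lemma fderiv_apply_of_hasFDerivAt {F : Coord → Coord} {F' : Fin 4 → Coord →L[ℝ] ℝ} {x : Coord}
    (h : ∀ i, HasFDerivAt (fun y => F y i) (F' i) x) (v : Coord) :
    fderiv ℝ F x v = ![F' 0 v, F' 1 v, F' 2 v, F' 3 v] := by
  rw [(hasFDerivAt_pi.2 h).fderiv]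
  ext i
  fin_cases i <;> rfl

/-! ### Derivatives of the frame fields, with `√Δ₋` and its derivative `δ'` kept symbolic -/

section Brackets

variable {x : Coord} {δ' : ℝ}

lemma fderiv_frame_zero (hx : 0 < x 1) (hΔ : 0 < M.deltaR (x 1))
    (hδ : HasDerivAt (fun r => √(M.deltaR r)) δ' (x 1)) (v : Coord) :
    fderiv ℝ (M.frame 0) x v =
      ![(2 * x 1 / √(M.deltaR (x 1)) / √(M.U (x 1) (x 2)) - (x 1 ^ 2 + M.a ^ 2) *
            (δ' / √(M.deltaR (x 1)) ^ 2 / √(M.U (x 1) (x 2)) +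
              x 1 / √(M.deltaR (x 1)) / √(M.U (x 1) (x 2)) ^ 3)) * v 1 +
          (x 1 ^ 2 + M.a ^ 2) * (M.a ^ 2 * Real.cos (x 2) * Real.sin (x 2)) /
            √(M.deltaR (x 1)) / √(M.U (x 1) (x 2)) ^ 3 * v 2, 0, 0,
        -(M.a * M.E * (δ' / √(M.deltaR (x 1)) ^ 2 / √(M.U (x 1) (x 2)) +
              x 1 / √(M.deltaR (x 1)) / √(M.U (x 1) (x 2)) ^ 3)) * v 1 +
          M.a * M.E * (M.a ^ 2 * Real.cos (x 2) * Real.sin (x 2)) /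
            √(M.deltaR (x 1)) / √(M.U (x 1) (x 2)) ^ 3 * v 2] := by
  have hd := (Real.sqrt_pos.2 hΔ).ne'
  have hu := (Real.sqrt_pos.2 (M.U_pos hx (x 2))).ne'
  have h0 := hasFDerivAt_mul_div_sqrt_U (M := M) hx
    ((((hasDerivAt_id (x 1)).pow 2).add_const (M.a ^ 2)).div hδ hd) (hasDerivAt_const (x 2) (1 : ℝ))
  have h3 := hasFDerivAt_mul_div_sqrt_U (M := M) hx
    ((hasDerivAt_const (x 1) (M.a * M.E)).div hδ hd) (hasDerivAt_const (x 2) (1 : ℝ))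
  rw [frame_zero, fderiv_apply_of_hasFDerivAt (F' := ![_, 0, 0, _])]
  swap
  · intro i
    fin_cases i
    exacts [h0, hasFDerivAt_const _ _, hasFDerivAt_const _ _, h3]
  congr! 1
  · simp
    field_simp
    ring
  · simp
    field_simp
    ring

lemma fderiv_frame_one (hx : 0 < x 1)
    (hδ : HasDerivAt (fun r => √(M.deltaR r)) δ' (x 1)) (v : Coord) :
    fderiv ℝ (M.frame 1) x v =
      ![0, (δ' / √(M.U (x 1) (x 2)) -
            √(M.deltaR (x 1)) * x 1 / √(M.U (x 1) (x 2)) ^ 3) * v 1 +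
          √(M.deltaR (x 1)) * (M.a ^ 2 * Real.cos (x 2) * Real.sin (x 2)) /
            √(M.U (x 1) (x 2)) ^ 3 * v 2, 0, 0] := by
  have h1 := hasFDerivAt_mul_div_sqrt_U (M := M) hx hδ (hasDerivAt_const (x 2) (1 : ℝ))
  rw [frame_one, fderiv_apply_of_hasFDerivAt (F' := ![0, _, 0, 0])]
  swap
  · intro i
    fin_cases i
    exacts [hasFDerivAt_const _ _, h1, hasFDerivAt_const _ _, hasFDerivAt_const _ _]
  simp

lemma fderiv_frame_two (hx : 0 < x 1) (v : Coord) :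
    fderiv ℝ (M.frame 2) x v =
      ![0, 0, -(√(M.deltaTheta (x 2)) * x 1 / √(M.U (x 1) (x 2)) ^ 3) * v 1 +
          (M.κ ^ 2 * M.a ^ 2 * Real.cos (x 2) * Real.sin (x 2) / √(M.deltaTheta (x 2)) /
              √(M.U (x 1) (x 2)) +
            √(M.deltaTheta (x 2)) * (M.a ^ 2 * Real.cos (x 2) * Real.sin (x 2)) /
              √(M.U (x 1) (x 2)) ^ 3) * v 2, 0] := by
  have h2 := hasFDerivAt_mul_div_sqrt_U (M := M) hx (hasDerivAt_const (x 1) (1 : ℝ))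
    (M.hasDerivAt_sqrt_deltaTheta (x 2))
  rw [frame_two, fderiv_apply_of_hasFDerivAt (F' := ![0, 0, _, 0])]
  swap
  · intro i
    fin_cases i
    exacts [hasFDerivAt_const _ _, hasFDerivAt_const _ _, h2, hasFDerivAt_const _ _]
  simp

/-- The `θ`-derivative of `(√Δ₋(θ))⁻¹ U^(-1/2)`. -/
def thetaFactor (M : KNAdS) (r θ : ℝ) : ℝ :=
  -(M.κ ^ 2 * M.a ^ 2 * Real.cos θ * Real.sin θ) / √(M.deltaTheta θ) ^ 3 / √(M.U r θ) +
    M.a ^ 2 * Real.cos θ * Real.sin θ / √(M.deltaTheta θ) / √(M.U r θ) ^ 3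

lemma fderiv_frame_three (hx : 0 < x 1) (hs : 0 < Real.sin (x 2)) (v : Coord) :
    fderiv ℝ (M.frame 3) x v =
      ![M.a * Real.sin (x 2) / √(M.deltaTheta (x 2)) * (x 1 / √(M.U (x 1) (x 2)) ^ 3) * v 1 -
          M.a * (Real.cos (x 2) / √(M.deltaTheta (x 2)) / √(M.U (x 1) (x 2)) +
            Real.sin (x 2) * M.thetaFactor (x 1) (x 2)) * v 2, 0, 0,
        M.E / Real.sin (x 2) / √(M.deltaTheta (x 2)) * (x 1 / √(M.U (x 1) (x 2)) ^ 3) * v 1 -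
          M.E * (-(Real.cos (x 2) / Real.sin (x 2) ^ 2) / √(M.deltaTheta (x 2)) /
              √(M.U (x 1) (x 2)) +
            1 / Real.sin (x 2) * M.thetaFactor (x 1) (x 2)) * v 2] := by
  have hd := (Real.sqrt_pos.2 (M.deltaTheta_pos (x 2))).ne'
  have hu := (Real.sqrt_pos.2 (M.U_pos hx (x 2))).ne'
  have hs' := hs.ne'
  have h0 := hasFDerivAt_mul_div_sqrt_U (M := M) hx (hasDerivAt_const (x 1) (1 : ℝ))
    (((Real.hasDerivAt_sin (x 2)).const_mul M.a).neg.div (M.hasDerivAt_sqrt_deltaTheta (x 2)) hd)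
  have h3 := hasFDerivAt_mul_div_sqrt_U (M := M) hx (hasDerivAt_const (x 1) (1 : ℝ))
    ((hasDerivAt_const (x 2) (-M.E)).div
      ((Real.hasDerivAt_sin (x 2)).mul (M.hasDerivAt_sqrt_deltaTheta (x 2))) (mul_ne_zero hs' hd))
  rw [frame_three, fderiv_apply_of_hasFDerivAt (F' := ![_, 0, 0, _])]
  swap
  · intro i
    fin_cases i
    exacts [h0, hasFDerivAt_const _ _, hasFDerivAt_const _ _, h3]
  congr! 1
  · simp [thetaFactor]
    field_simp
    ring
  · simp [thetaFactor]
    field_simp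
    ring

/-! ### The metric in the frame -/

lemma E_ne_zero (M : KNAdS) : M.E ≠ 0 := M.E_pos.ne'

lemma U_eq_sub (M : KNAdS) (r θ : ℝ) : M.U r θ = r ^ 2 + M.a ^ 2 - M.a ^ 2 * Real.sin θ ^ 2 := by
  rw [U, Real.sin_sq]
  ring

/-- Pairing with a frame vector gives, up to sign, a dual coframe form. With this and its three
analogues the components of a bracket are read off without expanding the metric. -/
lemma metric_frame_zero (hx : 0 < x 1) (hΔ : 0 < M.deltaR (x 1)) (v : Coord) :
    M.metric x v (M.frame 0 x) =
      -(√(M.deltaR (x 1)) / √(M.U (x 1) (x 2))) * M.formT x v := by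
  have hd := (Real.sqrt_pos.2 hΔ).ne'
  have hu := (Real.sqrt_pos.2 (M.U_pos hx (x 2))).ne'
  have hE := M.E_ne_zero
  have hT : M.formT x (M.frame 0 x) = √(M.U (x 1) (x 2)) / √(M.deltaR (x 1)) := by
    rw [frame_zero, formT]
    have := Real.sq_sqrt (M.U_nonneg (x 1) (x 2))
    rw [M.U_eq_sub] at this
    simp
    field_simp
    rw [M.U_eq_sub, this]
  have hP : M.formPhi x (M.frame 0 x) = 0 := by
    rw [frame_zero, formPhi]
    simp
    field_simp
    ring
  rw [metric, hT, hP]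
  have h1 := Real.sq_sqrt (M.U_nonneg (x 1) (x 2))
  have h2 := Real.sq_sqrt hΔ.le
  simp only [frame_zero, Matrix.cons_val]
  nth_rw 1 [← h1]
  nth_rw 1 [← h2]
  field_simp
  ring

lemma metric_frame_one (hx : 0 < x 1) (hΔ : 0 < M.deltaR (x 1)) (v : Coord) :
    M.metric x v (M.frame 1 x) = √(M.U (x 1) (x 2)) / √(M.deltaR (x 1)) * v 1 := by
  have hd := (Real.sqrt_pos.2 hΔ).ne'
  have hu := (Real.sqrt_pos.2 (M.U_pos hx (x 2))).ne'
  rw [metric]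
  have h1 := Real.sq_sqrt (M.U_nonneg (x 1) (x 2))
  have h2 := Real.sq_sqrt hΔ.le
  simp only [frame_one, Matrix.cons_val, formT, formPhi]
  nth_rw 2 [← h1]
  nth_rw 2 [← h2]
  field_simp
  ring

lemma metric_frame_two (hx : 0 < x 1) (v : Coord) :
    M.metric x v (M.frame 2 x) = √(M.U (x 1) (x 2)) / √(M.deltaTheta (x 2)) * v 2 := by
  have hd := (Real.sqrt_pos.2 (M.deltaTheta_pos (x 2))).ne'
  have hu := (Real.sqrt_pos.2 (M.U_pos hx (x 2))).ne'
  rw [metric]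
  have h1 := Real.sq_sqrt (M.U_nonneg (x 1) (x 2))
  have h2 := Real.sq_sqrt (M.deltaTheta_pos (x 2)).le
  simp only [frame_two, Matrix.cons_val, formT, formPhi]
  nth_rw 3 [← h1]
  nth_rw 1 [← h2]
  field_simp
  ring

lemma formT_frame_three : M.formT x (M.frame 3 x) = 0 := by
  have hE := M.E_ne_zero
  rw [frame_three, formT]
  simp
  field_simp
  by_cases hs : Real.sin (x 2) = 0
  · simp [hs]
  · ring

lemma formPhi_frame_three (hx : 0 < x 1) (hs : 0 < Real.sin (x 2)) :
    M.formPhi x (M.frame 3 x) =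
      √(M.U (x 1) (x 2)) / (Real.sin (x 2) * √(M.deltaTheta (x 2))) := by
  have hd := (Real.sqrt_pos.2 (M.deltaTheta_pos (x 2))).ne'
  have hu := (Real.sqrt_pos.2 (M.U_pos hx (x 2))).ne'
  have hE := M.E_ne_zero
  have hs' := hs.ne'
  rw [frame_three, formPhi]
  have := Real.sq_sqrt (M.U_nonneg (x 1) (x 2))
  rw [M.U_eq_sub] at this
  simp
  field_simp
  rw [M.U_eq_sub, this]
  ring

lemma metric_frame_three (hx : 0 < x 1) (hs : 0 < Real.sin (x 2)) (v : Coord) :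
    M.metric x v (M.frame 3 x) =
      √(M.deltaTheta (x 2)) * Real.sin (x 2) / √(M.U (x 1) (x 2)) * M.formPhi x v := by
  have hd := (Real.sqrt_pos.2 (M.deltaTheta_pos (x 2))).ne'
  have hu := (Real.sqrt_pos.2 (M.U_pos hx (x 2))).ne'
  have hs' := hs.ne'
  rw [metric, formT_frame_three, formPhi_frame_three hx hs]
  have h1 := Real.sq_sqrt (M.U_nonneg (x 1) (x 2))
  have h2 := Real.sq_sqrt (M.deltaTheta_pos (x 2)).le
  simp only [frame_three, Matrix.cons_val]
  nth_rw 4 [← h1]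
  nth_rw 2 [← h2]
  field_simp
  ring

end Brackets

/-! ### Structure coefficients of the frame -/

/-- The structure coefficients `⟨[e_α, e_β], e_γ⟩` of the frame. -/
def structureCoeff (M : KNAdS) (α β γ : Fin 4) (x : Coord) : ℝ :=
  M.metric x (VectorField.lieBracket ℝ (M.frame α) (M.frame β) x) (M.frame γ x)

variable {M : KNAdS}

lemma connection_eq (α β γ : Fin 4) (x : Coord) : M.connection α β γ x =
    (M.structureCoeff γ β α x - M.structureCoeff β α γ x + M.structureCoeff α γ β x) / 2 := rfl

/-- Antisymmetry reduces the table of brackets to six pairs. -/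
lemma structureCoeff_swap (α β γ : Fin 4) (x : Coord) :
    M.structureCoeff α β γ x = -M.structureCoeff β α γ x := by
  rw [structureCoeff, VectorField.lieBracket_swap, structureCoeff]
  simp only [metric, formT, formPhi, Pi.neg_apply]
  ring

lemma structureCoeff_self (α γ : Fin 4) (x : Coord) : M.structureCoeff α α γ x = 0 := by
  have := structureCoeff_swap (M := M) α α γ x
  linarith

section

variable {x : Coord} {u δ τ δ' : ℝ}

/-- Naming the three square roots `u`, `δ`, `τ` turns the computation into a rational identity; the
only relation it needs is `u² = r² + a² - a² sin² θ`. -/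
lemma structureCoeff_one_zero (hx : 0 < x 1) (hΔ : 0 < M.deltaR (x 1)) (hs : 0 < Real.sin (x 2))
    (hδ' : HasDerivAt (fun r => √(M.deltaR r)) δ' (x 1))
    (hu : √(M.U (x 1) (x 2)) = u) (hδ : √(M.deltaR (x 1)) = δ)
    (hτ : √(M.deltaTheta (x 2)) = τ) (γ : Fin 4) :
    M.structureCoeff 1 0 γ x = ![δ' / u - x 1 * δ / u ^ 3, 0, 0,
      2 * M.a * x 1 * Real.sin (x 2) * τ / u ^ 3] γ := by
  have hd0 := (Real.sqrt_pos.2 hΔ).ne'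
  have hu0 := (Real.sqrt_pos.2 (M.U_pos hx (x 2))).ne'
  have ht0 := (Real.sqrt_pos.2 (M.deltaTheta_pos (x 2))).ne'
  have hs0 := hs.ne'
  have hE := M.E_ne_zero
  have hU : √(M.U (x 1) (x 2)) ^ 2 = x 1 ^ 2 + M.a ^ 2 - M.a ^ 2 * Real.sin (x 2) ^ 2 := by
    rw [Real.sq_sqrt (M.U_nonneg _ _), U_eq_sub]
  have h0 : VectorField.lieBracket ℝ (M.frame 1) (M.frame 0) x =
      fderiv ℝ (M.frame 0) x (M.frame 1 x) - fderiv ℝ (M.frame 1) x (M.frame 0 x) := rfl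
  rw [fderiv_frame_one hx hδ', fderiv_frame_zero hx hΔ hδ'] at h0
  fin_cases γ
  all_goals simp only [structureCoeff, h0, Fin.zero_eta, Fin.mk_one, Fin.reduceFinMk]
  · rw [metric_frame_zero hx hΔ]
    simp [formT, frame_one, frame_zero, hu, hδ]
    rw [hu] at *
    rw [hδ] at *
    rw [hτ] at *
    field_simp
    linear_combination -(δ * x 1 + u ^ 2 * δ') * hU
  · rw [metric_frame_one hx hΔ]
    simp [frame_one, frame_zero, hu, hδ]
  · rw [metric_frame_two hx]
    simp [frame_one, frame_zero, hu, hδ, hτ]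
  · rw [metric_frame_three hx hs]
    simp [formPhi, frame_one, frame_zero, hu, hδ, hτ]
    rw [hu] at *
    rw [hδ] at *
    rw [hτ] at *
    field_simp
    ring

lemma structureCoeff_two_zero (hx : 0 < x 1) (hΔ : 0 < M.deltaR (x 1)) (hs : 0 < Real.sin (x 2))
    (hδ' : HasDerivAt (fun r => √(M.deltaR r)) δ' (x 1))
    (hu : √(M.U (x 1) (x 2)) = u) (hδ : √(M.deltaR (x 1)) = δ)
    (hτ : √(M.deltaTheta (x 2)) = τ) (γ : Fin 4) :
    M.structureCoeff 2 0 γ x =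
      ![-(τ * M.a ^ 2 * Real.cos (x 2) * Real.sin (x 2) / u ^ 3), 0, 0, 0] γ := by
  have hd0 := (Real.sqrt_pos.2 hΔ).ne'
  have hu0 := (Real.sqrt_pos.2 (M.U_pos hx (x 2))).ne'
  have ht0 := (Real.sqrt_pos.2 (M.deltaTheta_pos (x 2))).ne'
  have hs0 := hs.ne'
  have hE := M.E_ne_zero
  have hU : √(M.U (x 1) (x 2)) ^ 2 = x 1 ^ 2 + M.a ^ 2 - M.a ^ 2 * Real.sin (x 2) ^ 2 := by
    rw [Real.sq_sqrt (M.U_nonneg _ _), U_eq_sub]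
  have h0 : VectorField.lieBracket ℝ (M.frame 2) (M.frame 0) x =
      fderiv ℝ (M.frame 0) x (M.frame 2 x) - fderiv ℝ (M.frame 2) x (M.frame 0 x) := rfl
  rw [fderiv_frame_two hx, fderiv_frame_zero hx hΔ hδ'] at h0
  fin_cases γ
  all_goals simp only [structureCoeff, h0, Fin.zero_eta, Fin.mk_one, Fin.reduceFinMk]
  · rw [metric_frame_zero hx hΔ]
    simp [formT, frame_two, frame_zero, hu, hδ, hτ]
    rw [hu] at *
    rw [hδ] at *
    rw [hτ] at *
    field_simp
    linear_combination -(M.a ^ 2 * Real.cos (x 2)) * hU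
  · rw [metric_frame_one hx hΔ]
    simp [frame_two, frame_zero, hu, hδ, hτ]
  · rw [metric_frame_two hx]
    simp [frame_two, frame_zero, hu, hδ, hτ]
  · rw [metric_frame_three hx hs]
    simp [formPhi, frame_two, frame_zero, hu, hδ, hτ]
    rw [hu] at *
    rw [hδ] at *
    rw [hτ] at *
    right
    field_simp
    ring

/-- Both fields lie in the span of `∂_t` and `∂_φ` with coefficients independent of `t` and `φ`, so
they commute. -/
lemma structureCoeff_three_zero (hx : 0 < x 1) (hΔ : 0 < M.deltaR (x 1)) (hs : 0 < Real.sin (x 2))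
    (hδ' : HasDerivAt (fun r => √(M.deltaR r)) δ' (x 1))
    (hu : √(M.U (x 1) (x 2)) = u) (hδ : √(M.deltaR (x 1)) = δ)
    (hτ : √(M.deltaTheta (x 2)) = τ) (γ : Fin 4) :
    M.structureCoeff 3 0 γ x = ![0, 0, 0, 0] γ := by
  have hd0 := (Real.sqrt_pos.2 hΔ).ne'
  have hu0 := (Real.sqrt_pos.2 (M.U_pos hx (x 2))).ne'
  have ht0 := (Real.sqrt_pos.2 (M.deltaTheta_pos (x 2))).ne'
  have hs0 := hs.ne'
  have hE := M.E_ne_zero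
  have hU : √(M.U (x 1) (x 2)) ^ 2 = x 1 ^ 2 + M.a ^ 2 - M.a ^ 2 * Real.sin (x 2) ^ 2 := by
    rw [Real.sq_sqrt (M.U_nonneg _ _), U_eq_sub]
  have h0 : VectorField.lieBracket ℝ (M.frame 3) (M.frame 0) x =
      fderiv ℝ (M.frame 0) x (M.frame 3 x) - fderiv ℝ (M.frame 3) x (M.frame 0 x) := rfl
  rw [fderiv_frame_three hx hs, fderiv_frame_zero hx hΔ hδ'] at h0
  fin_cases γ
  all_goals simp only [structureCoeff, h0, Fin.zero_eta, Fin.mk_one, Fin.reduceFinMk]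
  · rw [metric_frame_zero hx hΔ]
    simp [formT, frame_three, frame_zero, hu, hδ, hτ]
  · rw [metric_frame_one hx hΔ]
    simp [frame_three, frame_zero, hu, hδ, hτ]
  · rw [metric_frame_two hx]
    simp [frame_three, frame_zero, hu, hδ, hτ]
  · rw [metric_frame_three hx hs]
    simp [formPhi, frame_three, frame_zero, hu, hδ, hτ]

lemma structureCoeff_one_two (hx : 0 < x 1) (hΔ : 0 < M.deltaR (x 1)) (hs : 0 < Real.sin (x 2))
    (hδ' : HasDerivAt (fun r => √(M.deltaR r)) δ' (x 1))
    (hu : √(M.U (x 1) (x 2)) = u) (hδ : √(M.deltaR (x 1)) = δ)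
    (hτ : √(M.deltaTheta (x 2)) = τ) (γ : Fin 4) :
    M.structureCoeff 1 2 γ x =
      ![0, -(τ * M.a ^ 2 * Real.cos (x 2) * Real.sin (x 2) / u ^ 3),
        -(δ * x 1 / u ^ 3), 0] γ := by
  have hd0 := (Real.sqrt_pos.2 hΔ).ne'
  have hu0 := (Real.sqrt_pos.2 (M.U_pos hx (x 2))).ne'
  have ht0 := (Real.sqrt_pos.2 (M.deltaTheta_pos (x 2))).ne'
  have hs0 := hs.ne'
  have hE := M.E_ne_zero
  have hU : √(M.U (x 1) (x 2)) ^ 2 = x 1 ^ 2 + M.a ^ 2 - M.a ^ 2 * Real.sin (x 2) ^ 2 := by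
    rw [Real.sq_sqrt (M.U_nonneg _ _), U_eq_sub]
  have h0 : VectorField.lieBracket ℝ (M.frame 1) (M.frame 2) x =
      fderiv ℝ (M.frame 2) x (M.frame 1 x) - fderiv ℝ (M.frame 1) x (M.frame 2 x) := rfl
  rw [fderiv_frame_one hx hδ', fderiv_frame_two hx] at h0
  fin_cases γ
  all_goals simp only [structureCoeff, h0, Fin.zero_eta, Fin.mk_one, Fin.reduceFinMk]
  · rw [metric_frame_zero hx hΔ]
    simp [formT, frame_one, frame_two, hu, hδ, hτ]
  · rw [metric_frame_one hx hΔ]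
    simp [frame_one, frame_two, hu, hδ, hτ]
    rw [hu] at *
    rw [hδ] at *
    rw [hτ] at *
    field_simp
  · rw [metric_frame_two hx]
    simp [frame_one, frame_two, hu, hδ, hτ]
    rw [hu] at *
    rw [hδ] at *
    rw [hτ] at *
    field_simp
  · rw [metric_frame_three hx hs]
    simp [formPhi, frame_one, frame_two, hu, hδ, hτ]

lemma structureCoeff_one_three (hx : 0 < x 1) (hΔ : 0 < M.deltaR (x 1)) (hs : 0 < Real.sin (x 2))
    (hδ' : HasDerivAt (fun r => √(M.deltaR r)) δ' (x 1))
    (hu : √(M.U (x 1) (x 2)) = u) (hδ : √(M.deltaR (x 1)) = δ)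
    (hτ : √(M.deltaTheta (x 2)) = τ) (γ : Fin 4) :
    M.structureCoeff 1 3 γ x = ![0, 0, 0, -(δ * x 1 / u ^ 3)] γ := by
  have hd0 := (Real.sqrt_pos.2 hΔ).ne'
  have hu0 := (Real.sqrt_pos.2 (M.U_pos hx (x 2))).ne'
  have ht0 := (Real.sqrt_pos.2 (M.deltaTheta_pos (x 2))).ne'
  have hs0 := hs.ne'
  have hE := M.E_ne_zero
  have hU : √(M.U (x 1) (x 2)) ^ 2 = x 1 ^ 2 + M.a ^ 2 - M.a ^ 2 * Real.sin (x 2) ^ 2 := by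
    rw [Real.sq_sqrt (M.U_nonneg _ _), U_eq_sub]
  have h0 : VectorField.lieBracket ℝ (M.frame 1) (M.frame 3) x =
      fderiv ℝ (M.frame 3) x (M.frame 1 x) - fderiv ℝ (M.frame 1) x (M.frame 3 x) := rfl
  rw [fderiv_frame_one hx hδ', fderiv_frame_three hx hs] at h0
  fin_cases γ
  all_goals simp only [structureCoeff, h0, Fin.zero_eta, Fin.mk_one, Fin.reduceFinMk]
  · rw [metric_frame_zero hx hΔ]
    simp [formT, frame_one, frame_three, hu, hδ, hτ]
    rw [hu] at *
    rw [hδ] at *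
    rw [hτ] at *
    right
    field_simp
    ring
  · rw [metric_frame_one hx hΔ]
    simp [frame_one, frame_three, hu, hδ, hτ]
  · rw [metric_frame_two hx]
    simp [frame_one, frame_three, hu, hδ, hτ]
  · rw [metric_frame_three hx hs]
    simp [formPhi, frame_one, frame_three, hu, hδ, hτ]
    rw [hu] at *
    rw [hδ] at *
    rw [hτ] at *
    field_simp
    linear_combination hU

lemma structureCoeff_two_three (hx : 0 < x 1) (hΔ : 0 < M.deltaR (x 1)) (hs : 0 < Real.sin (x 2))
    (hu : √(M.U (x 1) (x 2)) = u) (hδ : √(M.deltaR (x 1)) = δ)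
    (hτ : √(M.deltaTheta (x 2)) = τ) (γ : Fin 4) :
    M.structureCoeff 2 3 γ x = ![2 * M.a * Real.cos (x 2) * δ / u ^ 3, 0, 0,
      -(M.κ ^ 2 * M.a ^ 2 * Real.cos (x 2) * Real.sin (x 2) / (τ * u) +
        τ * M.a ^ 2 * Real.cos (x 2) * Real.sin (x 2) / u ^ 3 +
        τ * Real.cos (x 2) / (u * Real.sin (x 2)))] γ := by
  have hd0 := (Real.sqrt_pos.2 hΔ).ne'
  have hu0 := (Real.sqrt_pos.2 (M.U_pos hx (x 2))).ne'
  have ht0 := (Real.sqrt_pos.2 (M.deltaTheta_pos (x 2))).ne'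
  have hs0 := hs.ne'
  have hE := M.E_ne_zero
  have hU : √(M.U (x 1) (x 2)) ^ 2 = x 1 ^ 2 + M.a ^ 2 - M.a ^ 2 * Real.sin (x 2) ^ 2 := by
    rw [Real.sq_sqrt (M.U_nonneg _ _), U_eq_sub]
  have h0 : VectorField.lieBracket ℝ (M.frame 2) (M.frame 3) x =
      fderiv ℝ (M.frame 3) x (M.frame 2 x) - fderiv ℝ (M.frame 2) x (M.frame 3 x) := rfl
  rw [fderiv_frame_two hx, fderiv_frame_three hx hs] at h0
  fin_cases γ
  all_goals simp only [structureCoeff, h0, Fin.zero_eta, Fin.mk_one, Fin.reduceFinMk]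
  · rw [metric_frame_zero hx hΔ]
    simp [formT, frame_two, frame_three, hu, hδ, hτ]
    rw [hu] at *
    rw [hδ] at *
    rw [hτ] at *
    field_simp
    ring
  · rw [metric_frame_one hx hΔ]
    simp [frame_two, frame_three, hu, hδ, hτ]
  · rw [metric_frame_two hx]
    simp [frame_two, frame_three, hu, hτ]
  · rw [metric_frame_three hx hs]
    simp [formPhi, thetaFactor, frame_two, frame_three, hu, hτ]
    rw [hu] at *
    rw [hδ] at *
    rw [hτ] at *
    field_simp
    linear_combination -(Real.cos (x 2) *
      (Real.sin (x 2) ^ 2 * M.a ^ 2 * (τ ^ 2 - M.κ ^ 2 * u ^ 2) - τ ^ 2 * u ^ 2)) * hU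

end

/-! ### The spin connection term -/

lemma clifford_zero_mulVec (v : Spinor) : clifford 0 *ᵥ v = ![-v 2, -v 3, -v 0, -v 1] := by
  ext i
  fin_cases i <;> simp [clifford, Matrix.mulVec, dotProduct, Fin.sum_univ_four]

lemma clifford_one_mulVec (v : Spinor) : clifford 1 *ᵥ v = ![-v 2, v 3, v 0, -v 1] := by
  ext i
  fin_cases i <;> simp [clifford, Matrix.mulVec, dotProduct, Fin.sum_univ_four]

lemma clifford_two_mulVec (v : Spinor) : clifford 2 *ᵥ v = ![v 3, v 2, -v 1, -v 0] := by
  ext i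
  fin_cases i <;> simp [clifford, Matrix.mulVec, dotProduct, Fin.sum_univ_four]

lemma clifford_three_mulVec (v : Spinor) : clifford 3 *ᵥ v =
    ![Complex.I * v 3, -Complex.I * v 2, -Complex.I * v 1, Complex.I * v 0] := by
  ext i
  fin_cases i <;> simp [clifford, Matrix.mulVec, dotProduct, Fin.sum_univ_four]

/-- The array of structure coefficients with the given non-zero entries. -/
def coeffTable (c100 c103 c200 c121 c122 c133 c230 c233 : ℝ) : Fin 4 → Fin 4 → Fin 4 → ℝ :=
  ![![![0, 0, 0, 0], ![-c100, 0, 0, -c103], ![-c200, 0, 0, 0], ![0, 0, 0, 0]],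
    ![![c100, 0, 0, c103], ![0, 0, 0, 0], ![0, c121, c122, 0], ![0, 0, 0, c133]],
    ![![c200, 0, 0, 0], ![0, -c121, -c122, 0], ![0, 0, 0, 0], ![c230, 0, 0, c233]],
    ![![0, 0, 0, 0], ![0, 0, 0, -c133], ![-c230, 0, 0, -c233], ![0, 0, 0, 0]]]

/-- In a Clifford contraction of the spin connection only traces and the totally antisymmetric part
survive. The traces give the real halves, and the antisymmetric part gives the terms with `c230` and
`c103`. -/
lemma sum_clifford_coeffTable {c : Fin 4 → Fin 4 → Fin 4 → ℝ}
    {c100 c103 c200 c121 c122 c133 c230 c233 : ℝ}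
    (hc : c = coeffTable c100 c103 c200 c121 c122 c133 c230 c233) (v : Spinor) :
    ∑ γ, clifford γ *ᵥ ((1 / 4 : ℂ) • ∑ α, ∑ β,
        (((c γ β α - c β α γ + c α γ β) / 2 : ℝ) : ℂ) • (clifford α * clifford β) *ᵥ v) =
      ![((c100 - c122 - c133) / 2 + Complex.I * (c230 / 4)) * v 2
          - ((c200 + c121 - c233) / 2 + Complex.I * (c103 / 4)) * v 3,
        -((c100 - c122 - c133) / 2 + Complex.I * (c230 / 4)) * v 3
          - ((c200 + c121 - c233) / 2 + Complex.I * (c103 / 4)) * v 2,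
        -((c100 - c122 - c133) / 2 - Complex.I * (c230 / 4)) * v 0
          + ((c200 + c121 - c233) / 2 - Complex.I * (c103 / 4)) * v 1,
        ((c100 - c122 - c133) / 2 - Complex.I * (c230 / 4)) * v 1
          + ((c200 + c121 - c233) / 2 - Complex.I * (c103 / 4)) * v 0] := by
  subst hc
  simp only [← Matrix.mulVec_mulVec, Fin.sum_univ_four, clifford_zero_mulVec,
    clifford_one_mulVec, clifford_two_mulVec, clifford_three_mulVec, coeffTable, Matrix.cons_val]
  ext i
  fin_cases i
  all_goals
    simp
    ring_nf
    simp only [Complex.I_sq]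
    ring

lemma differentiable_deltaR (M : KNAdS) : Differentiable ℝ M.deltaR :=
  M.deltaPoly.differentiable

lemma hasDerivAt_sqrt_deltaR {r : ℝ} (hΔ : 0 < M.deltaR r) :
    HasDerivAt (fun s => √(M.deltaR s)) (deriv M.deltaR r / (2 * √(M.deltaR r))) r :=
  (M.differentiable_deltaR r).hasDerivAt.sqrt hΔ.ne'

/-! ### The full bracket table, the potential in the frame, and the split of the Dirac operator -/

section Point

variable {x : Coord} {u δ τ δ' : ℝ}

lemma structureCoeff_eq_coeffTable (hx : 0 < x 1) (hΔ : 0 < M.deltaR (x 1))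
    (hs : 0 < Real.sin (x 2)) (hδ' : HasDerivAt (fun r => √(M.deltaR r)) δ' (x 1))
    (hu : √(M.U (x 1) (x 2)) = u) (hδ : √(M.deltaR (x 1)) = δ)
    (hτ : √(M.deltaTheta (x 2)) = τ) :
    (fun α β γ => M.structureCoeff α β γ x) = coeffTable (δ' / u - x 1 * δ / u ^ 3)
      (2 * M.a * x 1 * Real.sin (x 2) * τ / u ^ 3)
      (-(τ * M.a ^ 2 * Real.cos (x 2) * Real.sin (x 2) / u ^ 3))
      (-(τ * M.a ^ 2 * Real.cos (x 2) * Real.sin (x 2) / u ^ 3)) (-(δ * x 1 / u ^ 3))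
      (-(δ * x 1 / u ^ 3)) (2 * M.a * Real.cos (x 2) * δ / u ^ 3)
      (-(M.κ ^ 2 * M.a ^ 2 * Real.cos (x 2) * Real.sin (x 2) / (τ * u) +
        τ * M.a ^ 2 * Real.cos (x 2) * Real.sin (x 2) / u ^ 3 +
        τ * Real.cos (x 2) / (u * Real.sin (x 2)))) := by
  have h10 := structureCoeff_one_zero hx hΔ hs hδ' hu hδ hτ
  have h20 := structureCoeff_two_zero hx hΔ hs hδ' hu hδ hτ
  have h30 := structureCoeff_three_zero hx hΔ hs hδ' hu hδ hτ
  have h12 := structureCoeff_one_two hx hΔ hs hδ' hu hδ hτ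
  have h13 := structureCoeff_one_three hx hΔ hs hδ' hu hδ hτ
  have h23 := structureCoeff_two_three hx hΔ hs hu hδ hτ
  have h01 (γ) := structureCoeff_swap (M := M) 0 1 γ x
  have h02 (γ) := structureCoeff_swap (M := M) 0 2 γ x
  have h03 (γ) := structureCoeff_swap (M := M) 0 3 γ x
  have h21 (γ) := structureCoeff_swap (M := M) 2 1 γ x
  have h31 (γ) := structureCoeff_swap (M := M) 3 1 γ x
  have h32 (γ) := structureCoeff_swap (M := M) 3 2 γ x
  simp only [h10, h20, h30, h12, h13, h23] at h01 h02 h03 h21 h31 h32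
  funext α β γ
  fin_cases α <;> fin_cases β <;>
    simp only [structureCoeff_self, h10, h20, h30, h12, h13, h23, h01, h02, h03, h21, h31, h32,
      Fin.zero_eta, Fin.mk_one, Fin.reduceFinMk, coeffTable] <;>
    fin_cases γ <;> simp

lemma potential_frame_zero (hx : 0 < x 1) (hΔ : 0 < M.deltaR (x 1))
    (hu : √(M.U (x 1) (x 2)) = u) (hδ : √(M.deltaR (x 1)) = δ) :
    M.potential x (M.frame 0 x) = -(M.Q * x 1 / (u * δ)) := by
  have hd0 := (Real.sqrt_pos.2 hΔ).ne'
  have hu0 := (Real.sqrt_pos.2 (M.U_pos hx (x 2))).ne'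
  have hE := M.E_ne_zero
  have hU := M.U_eq_sub (x 1) (x 2)
  have hU2 : M.U (x 1) (x 2) = u ^ 2 := by rw [← hu, Real.sq_sqrt (M.U_nonneg _ _)]
  rw [hU2] at hU
  rw [hδ] at hd0
  rw [hu] at hu0
  simp only [potential, formT, formPhi, frame_zero, Matrix.cons_val, hu, hδ]
  rw [hU2]
  field_simp
  linear_combination (M.Q * x 1) * hU

lemma potential_frame_one : M.potential x (M.frame 1 x) = 0 := by
  simp [potential, formT, formPhi, frame_one]

lemma potential_frame_two : M.potential x (M.frame 2 x) = 0 := by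
  simp [potential, formT, formPhi, frame_two]

lemma potential_frame_three (hx : 0 < x 1) (hs : 0 < Real.sin (x 2))
    (hu : √(M.U (x 1) (x 2)) = u) (hτ : √(M.deltaTheta (x 2)) = τ) :
    M.potential x (M.frame 3 x) = -(M.P * Real.cos (x 2) / (u * (Real.sin (x 2) * τ))) := by
  have hu0 := (Real.sqrt_pos.2 (M.U_pos hx (x 2))).ne'
  have ht0 := (Real.sqrt_pos.2 (M.deltaTheta_pos (x 2))).ne'
  have hs0 := hs.ne'
  have hU2 : M.U (x 1) (x 2) = u ^ 2 := by rw [← hu, Real.sq_sqrt (M.U_nonneg _ _)]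
  rw [potential, formT_frame_three, formPhi_frame_three hx hs, hu, hτ, hU2]
  rw [hτ] at ht0
  rw [hu] at hu0
  field_simp
  ring

lemma dirac_eq_sub (Ψ : Coord → Spinor) (x : Coord) : M.dirac Ψ x =
    ∑ α, clifford α *ᵥ (fderiv ℝ Ψ x (M.frame α x) +
      (Complex.I * (M.potential x (M.frame α x) : ℂ)) • Ψ x) -
    ∑ γ, clifford γ *ᵥ ((1 / 4 : ℂ) • ∑ α, ∑ β,
        (((M.structureCoeff γ β α x - M.structureCoeff β α γ x +
          M.structureCoeff α γ β x) / 2 : ℝ) : ℂ) • (clifford α * clifford β) *ᵥ Ψ x) := by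
  rw [dirac, ← Finset.sum_sub_distrib]
  refine Finset.sum_congr rfl fun γ _ => ?_
  rw [← Matrix.mulVec_sub, spinDeriv]
  congr 1
  simp only [connection_eq]
  abel

end Point

/-! ### The weight `S₋` and its derivatives -/

/-- The factors `(r ± i a cos θ)^(1/2)` of the matrix `S₋`. -/
def rootFactor (M : KNAdS) (ε r θ : ℝ) : ℂ :=
  ((r : ℂ) + Complex.I * ((ε * M.a * Real.cos θ : ℝ) : ℂ)) ^ (1 / 2 : ℂ)

lemma rootFactor_sq (ε r θ : ℝ) : M.rootFactor ε r θ ^ 2 =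
    (r : ℂ) + Complex.I * ((ε * M.a * Real.cos θ : ℝ) : ℂ) := by
  rw [rootFactor, ← Complex.cpow_nat_mul]
  norm_num

lemma rootFactor_ne_zero (ε θ : ℝ) {r : ℝ} (hr : 0 < r) : M.rootFactor ε r θ ≠ 0 := by
  intro h
  have h2 := M.rootFactor_sq ε r θ
  rw [h] at h2
  have := congrArg Complex.re h2
  simp at this
  exact hr.ne this

/-- For `r > 0` the base avoids the branch cut, so the principal root commutes with conjugation. The
two factors are conjugate and their product is the modulus of `r + i a cos θ`. -/
lemma rootFactor_mul (θ : ℝ) {r : ℝ} (hr : 0 < r) :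
    M.rootFactor 1 r θ * M.rootFactor (-1) r θ = √(M.U r θ) := by
  have h2 : ((r : ℂ) + Complex.I * ((-1 * M.a * Real.cos θ : ℝ) : ℂ)) =
      (starRingEnd ℂ) ((r : ℂ) + Complex.I * ((1 * M.a * Real.cos θ : ℝ) : ℂ)) := by
    simp only [map_add, map_mul, Complex.conj_I, Complex.conj_ofReal]
    push_cast
    ring
  have h3 : M.rootFactor (-1) r θ = (starRingEnd ℂ) (M.rootFactor 1 r θ) := by
    have : ((r : ℂ) + Complex.I * ((1 * M.a * Real.cos θ : ℝ) : ℂ)).arg ≠ Real.pi := by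
      intro h
      rw [Complex.arg_eq_pi_iff] at h
      have := h.1
      simp at this
      linarith
    rw [rootFactor, rootFactor, h2, Complex.conj_cpow _ _ this, map_div₀, map_one, map_ofNat]
  rw [h3, Complex.mul_conj', ← Complex.ofReal_pow, ← norm_pow, rootFactor_sq, Complex.norm_def,
    mul_comm Complex.I, Complex.normSq_add_mul_I, U]
  congr 3
  ring

lemma hasDerivAt_cpow_half {f : ℝ → ℂ} {f' : ℂ} {s : ℝ} (hf : HasDerivAt f f' s)
    (hre : 0 < (f s).re) :
    HasDerivAt (fun y => f y ^ (1 / 2 : ℂ)) (f' / (2 * f s ^ (1 / 2 : ℂ))) s := by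
  have h1 : HasDerivAt (fun z : ℂ => z ^ (1 / 2 : ℂ)) _ (f s) :=
    (hasDerivAt_id (f s)).cpow_const (Or.inl hre)
  refine (h1.scomp s hf).congr_deriv ?_
  have h0 : f s ≠ 0 := by
    intro h
    simp [h] at hre
  have h2 : (f s) ^ (1 / 2 - 1 : ℂ) = ((f s) ^ (1 / 2 : ℂ))⁻¹ := by
    rw [← Complex.cpow_neg]
    norm_num
  simp only [id, h2, smul_eq_mul]
  have h3 : f s ^ (1 / 2 : ℂ) ≠ 0 := by simp [Complex.cpow_eq_zero_iff, h0]
  field_simp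

lemma hasDerivAt_rootFactor_left (ε θ : ℝ) {r : ℝ} (hr : 0 < r) :
    HasDerivAt (fun s => M.rootFactor ε s θ) (1 / (2 * M.rootFactor ε r θ)) r := by
  have h : HasDerivAt (fun s : ℝ => (s : ℂ) + Complex.I * ((ε * M.a * Real.cos θ : ℝ) : ℂ)) 1 r :=
    (Complex.ofRealCLM.hasDerivAt (x := r)).add_const _
  exact hasDerivAt_cpow_half h (by simpa using hr)

lemma hasDerivAt_rootFactor_right (ε θ : ℝ) {r : ℝ} (hr : 0 < r) :
    HasDerivAt (fun y => M.rootFactor ε r y)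
      (-(Complex.I * ε * M.a * Real.sin θ) / (2 * M.rootFactor ε r θ)) θ := by
  have h : HasDerivAt (fun y : ℝ => (r : ℂ) + Complex.I * ((ε * M.a * Real.cos y : ℝ) : ℂ))
      (-(Complex.I * ε * M.a * Real.sin θ)) θ := by
    refine ((((Real.hasDerivAt_cos θ).const_mul (ε * M.a)).ofReal_comp.const_mul
      Complex.I).const_add _).congr_deriv ?_
    push_cast
    ring
  exact hasDerivAt_cpow_half h (by simpa using hr)

lemma rpow_quarter_eq {y : ℝ} (hy : 0 ≤ y) : y ^ (1 / 4 : ℝ) = √(√y) := by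
  rw [Real.sqrt_eq_rpow, Real.sqrt_eq_rpow, ← Real.rpow_mul hy]
  norm_num

lemma hasDerivAt_rpow_quarter {r : ℝ} (hΔ : 0 < M.deltaR r) {δ' : ℝ}
    (hδ' : HasDerivAt (fun r => √(M.deltaR r)) δ' r) :
    HasDerivAt (fun s => ((M.deltaR s ^ (1 / 4 : ℝ) : ℝ) : ℂ))
      ((δ' / (2 * M.deltaR r ^ (1 / 4 : ℝ)) : ℝ) : ℂ) r := by
  have h1 := (hδ'.sqrt (Real.sqrt_pos.2 hΔ).ne').ofReal_comp
  rw [rpow_quarter_eq hΔ.le]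
  refine h1.congr_of_eventuallyEq ?_
  filter_upwards [(M.differentiable_deltaR r).continuousAt.eventually (lt_mem_nhds hΔ)] with s hs
  rw [rpow_quarter_eq (le_of_lt hs)]

/-! ### Separated components -/

/-- A component of a separated spinor field. -/
def sepComponent (M : KNAdS) (ω : ℝ) (k : ℤ) (ε : ℝ) (X Y : ℝ → ℂ) (x : Coord) : ℂ :=
  Complex.exp (-Complex.I * ((ω * x 0 + ((k : ℝ) + 1 / 2) * x 3 : ℝ) : ℂ)) *
    ((((M.deltaR (x 1) ^ (1 / 4 : ℝ) : ℝ) : ℂ) * M.rootFactor ε (x 1) (x 2))⁻¹ *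
      (X (x 1) * Y (x 2)))

lemma separated_eq (ω : ℝ) (k : ℤ) (Xp Xm Yp Ym : ℝ → ℂ) :
    M.separated ω k Xp Xm Yp Ym = fun x => ![M.sepComponent ω k 1 Xm Ym x,
      M.sepComponent ω k 1 Xp Yp x, M.sepComponent ω k (-1) Xp Ym x,
      M.sepComponent ω k (-1) Xm Yp x] := by
  funext x
  have h1 : (x 1 : ℂ) - Complex.I * ((M.a * Real.cos (x 2) : ℝ) : ℂ) =
      (x 1 : ℂ) + Complex.I * ((-1 * M.a * Real.cos (x 2) : ℝ) : ℂ) := by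
    push_cast
    ring
  ext i
  fin_cases i <;> simp only [separated, sepComponent, rootFactor, h1, one_mul] <;> simp

section

variable {ω : ℝ} {k : ℤ} {ε : ℝ} {X Y : ℝ → ℂ} {X' Y' : ℂ} {r θ : ℝ}

lemma sepComponent_slice (r θ : ℝ) : M.sepComponent ω k ε X Y ![0, r, θ, 0] =
    (((M.deltaR r ^ (1 / 4 : ℝ) : ℝ) : ℂ) * M.rootFactor ε r θ)⁻¹ * (X r * Y θ) := by
  simp [sepComponent]

lemma hasDerivAt_sepComponent_t (r θ : ℝ) :
    HasDerivAt (fun s => M.sepComponent ω k ε X Y ![s, r, θ, 0])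
      (-Complex.I * ω * M.sepComponent ω k ε X Y ![0, r, θ, 0]) 0 := by
  have h : HasDerivAt (fun s : ℝ => Complex.exp (-Complex.I * ((ω * s : ℝ) : ℂ)))
      (-Complex.I * ω) 0 := by
    refine ((((hasDerivAt_id (0 : ℝ)).const_mul ω).ofReal_comp.const_mul
      (-Complex.I)).cexp).congr_deriv ?_
    simp
  rw [sepComponent_slice]
  simpa [sepComponent] using h.mul_const _

lemma hasDerivAt_sepComponent_phi (r θ : ℝ) :
    HasDerivAt (fun s => M.sepComponent ω k ε X Y ![0, r, θ, s])
      (-Complex.I * (k + 1 / 2) * M.sepComponent ω k ε X Y ![0, r, θ, 0]) 0 := by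
  have h : HasDerivAt (fun s : ℝ => Complex.exp (-Complex.I * ((((k : ℝ) + 1 / 2) * s : ℝ) : ℂ)))
      (-Complex.I * (k + 1 / 2)) 0 := by
    refine ((((hasDerivAt_id (0 : ℝ)).const_mul ((k : ℝ) + 1 / 2)).ofReal_comp.const_mul
      (-Complex.I)).cexp).congr_deriv ?_
    simp
  rw [sepComponent_slice]
  simpa [sepComponent] using h.mul_const _

lemma quarter_ne_zero (hΔ : 0 < M.deltaR r) : ((M.deltaR r ^ (1 / 4 : ℝ) : ℝ) : ℂ) ≠ 0 :=
  Complex.ofReal_ne_zero.2 (Real.rpow_pos_of_pos hΔ _).ne'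

/-- The subtracted coefficient is the logarithmic derivative of the weight `Δ₋^(1/4) z^(1/2)`. It is
kept apart because it will cancel against the connection. -/
lemma hasDerivAt_sepComponent_r (hr : 0 < r) (hΔ : 0 < M.deltaR r) {δ' : ℝ}
    (hδ' : HasDerivAt (fun r => √(M.deltaR r)) δ' r) (hX : HasDerivAt X X' r) (θ : ℝ) :
    HasDerivAt (fun s => M.sepComponent ω k ε X Y ![0, s, θ, 0])
      ((((M.deltaR r ^ (1 / 4 : ℝ) : ℝ) : ℂ) * M.rootFactor ε r θ)⁻¹ * (X' * Y θ) -
        (δ' / (2 * √(M.deltaR r)) + 1 / (2 * M.rootFactor ε r θ ^ 2)) *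
          M.sepComponent ω k ε X Y ![0, r, θ, 0]) r := by
  have hd := quarter_ne_zero hΔ
  have hz := M.rootFactor_ne_zero ε θ hr
  have h := (((hasDerivAt_rpow_quarter hΔ hδ').mul
    (hasDerivAt_rootFactor_left (M := M) ε θ hr)).inv (mul_ne_zero hd hz)).mul (hX.mul_const (Y θ))
  simp only [sepComponent_slice]
  refine h.congr_deriv ?_
  have h4 : (√(M.deltaR r) : ℂ) = ((M.deltaR r ^ (1 / 4 : ℝ) : ℝ) : ℂ) ^ 2 := by
    rw [rpow_quarter_eq hΔ.le, ← Complex.ofReal_pow, Real.sq_sqrt (Real.sqrt_nonneg _)]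
  rw [h4]
  push_cast
  simp only [Pi.mul_apply, Pi.inv_apply]
  generalize ((M.deltaR r ^ (1 / 4 : ℝ) : ℝ) : ℂ) = d at *
  field_simp
  ring

lemma hasDerivAt_sepComponent_theta (hr : 0 < r) (hΔ : 0 < M.deltaR r)
    (hY : HasDerivAt Y Y' θ) :
    HasDerivAt (fun s => M.sepComponent ω k ε X Y ![0, r, s, 0])
      ((((M.deltaR r ^ (1 / 4 : ℝ) : ℝ) : ℂ) * M.rootFactor ε r θ)⁻¹ * (X r * Y') +
        Complex.I * ε * M.a * Real.sin θ / (2 * M.rootFactor ε r θ ^ 2) *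
          M.sepComponent ω k ε X Y ![0, r, θ, 0]) θ := by
  have hd := quarter_ne_zero hΔ
  have hz := M.rootFactor_ne_zero ε θ hr
  have h := (((hasDerivAt_rootFactor_right (M := M) ε θ hr).const_mul
    ((M.deltaR r ^ (1 / 4 : ℝ) : ℝ) : ℂ)).inv (mul_ne_zero hd hz)).mul (hY.const_mul (X r))
  simp only [sepComponent_slice]
  refine h.congr_deriv ?_
  simp only [Pi.inv_apply]
  generalize ((M.deltaR r ^ (1 / 4 : ℝ) : ℝ) : ℂ) = d at *
  field_simp
  ring

end

/-! ### Partial derivatives along coordinate lines -/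

lemma fderiv_apply_eq_sum {Ψ : Coord → Spinor} {x : Coord} (v : Coord) (j : Fin 4) :
    fderiv ℝ Ψ x v j = ∑ i, (v i : ℂ) * fderiv ℝ Ψ x (Pi.single i 1) j := by
  conv_lhs => rw [pi_eq_sum_univ' v]
  simp

lemma hasDerivAt_line {Ψ : Coord → Spinor} {x : Coord} (hΨ : DifferentiableAt ℝ Ψ x)
    {γ : ℝ → Coord} {s : ℝ} {v : Coord} (hγ : HasDerivAt γ v s) (hs : γ s = x) (j : Fin 4) :
    HasDerivAt (fun y => Ψ (γ y) j) (fderiv ℝ Ψ x v j) s := by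
  subst hs
  exact hasDerivAt_pi.1 (hΨ.hasFDerivAt.comp_hasDerivAt s hγ) j

lemma hasDerivAt_line_t (r θ : ℝ) :
    HasDerivAt (fun s : ℝ => (![s, r, θ, 0] : Coord)) (Pi.single 0 1) 0 := by
  refine hasDerivAt_pi.2 fun i => ?_
  fin_cases i
  exacts [hasDerivAt_id _, hasDerivAt_const _ _, hasDerivAt_const _ _, hasDerivAt_const _ _]

lemma hasDerivAt_line_r (r θ : ℝ) :
    HasDerivAt (fun s : ℝ => (![0, s, θ, 0] : Coord)) (Pi.single 1 1) r := by
  refine hasDerivAt_pi.2 fun i => ?_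
  fin_cases i
  exacts [hasDerivAt_const _ _, hasDerivAt_id _, hasDerivAt_const _ _, hasDerivAt_const _ _]

lemma hasDerivAt_line_theta (r θ : ℝ) :
    HasDerivAt (fun s : ℝ => (![0, r, s, 0] : Coord)) (Pi.single 2 1) θ := by
  refine hasDerivAt_pi.2 fun i => ?_
  fin_cases i
  exacts [hasDerivAt_const _ _, hasDerivAt_const _ _, hasDerivAt_id _, hasDerivAt_const _ _]

lemma hasDerivAt_line_phi (r θ : ℝ) :
    HasDerivAt (fun s : ℝ => (![0, r, θ, s] : Coord)) (Pi.single 3 1) 0 := by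
  refine hasDerivAt_pi.2 fun i => ?_
  fin_cases i
  exacts [hasDerivAt_const _ _, hasDerivAt_const _ _, hasDerivAt_const _ _, hasDerivAt_id _]

lemma isOpen_exterior (re : ℝ) : IsOpen (exterior re) := by
  refine (isOpen_lt continuous_const (continuous_apply 1)).inter
    ((isOpen_lt continuous_const (continuous_apply 2)).inter
      (isOpen_lt (continuous_apply 2) continuous_const))

/-! ### The Dirac equation for separated spinor fields -/

section Frame

variable {re ω : ℝ} {k : ℤ} {r θ : ℝ} {u δ τ δ' : ℝ}

lemma one_div_rootFactor_sq (ε : ℝ) (hε : ε ^ 2 = 1) (hr : 0 < r)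
    (hu : √(M.U r θ) = u) : 1 / M.rootFactor ε r θ ^ 2 =
      (r - Complex.I * ε * M.a * Real.cos θ) / (u : ℂ) ^ 2 := by
  have hz := pow_ne_zero 2 (M.rootFactor_ne_zero ε θ hr)
  have hu0 : (u : ℂ) ≠ 0 :=
    Complex.ofReal_ne_zero.2 (hu ▸ (Real.sqrt_pos.2 (M.U_pos hr θ)).ne')
  have hu2 : (u : ℂ) ^ 2 = r ^ 2 + M.a ^ 2 * Real.cos θ ^ 2 := by
    rw [← Complex.ofReal_pow, ← hu, Real.sq_sqrt (M.U_nonneg _ _), U]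
    push_cast
    ring
  have hε' : (ε : ℂ) ^ 2 = 1 := by exact_mod_cast hε
  rw [div_eq_div_iff hz (pow_ne_zero 2 hu0), hu2, rootFactor_sq]
  push_cast
  linear_combination (M.a ^ 2 * Complex.cos θ ^ 2 * Complex.I ^ 2) * hε' +
    M.a ^ 2 * Complex.cos θ ^ 2 * Complex.I_sq

variable {Ψ : Coord → Spinor} {j : Fin 4}

lemma frame_zero_component (hr : 0 < r) (hΔ : 0 < M.deltaR r)
    (hu : √(M.U r θ) = u) (hδ : √(M.deltaR r) = δ) {ψ : ℂ}
    (ht : fderiv ℝ Ψ ![0, r, θ, 0] (Pi.single 0 1) j = -Complex.I * ω * ψ)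
    (hp : fderiv ℝ Ψ ![0, r, θ, 0] (Pi.single 3 1) j = -Complex.I * (k + 1 / 2) * ψ) :
    (u : ℂ) * (fderiv ℝ Ψ ![0, r, θ, 0] (M.frame 0 ![0, r, θ, 0]) j +
      Complex.I * (M.potential ![0, r, θ, 0] (M.frame 0 ![0, r, θ, 0]) : ℂ) * ψ) =
      -(Complex.I * M.radialK ω k r / δ) * ψ := by
  have hd0 : (δ : ℂ) ≠ 0 := Complex.ofReal_ne_zero.2 (hδ ▸ (Real.sqrt_pos.2 hΔ).ne')
  have hu0 : (u : ℂ) ≠ 0 :=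
    Complex.ofReal_ne_zero.2 (hu ▸ (Real.sqrt_pos.2 (M.U_pos hr θ)).ne')
  rw [potential_frame_zero (x := ![0, r, θ, 0]) hr hΔ hu hδ, fderiv_apply_eq_sum,
    Fin.sum_univ_four, ht, hp, frame_zero]
  simp [hu, hδ, radialK]
  field_simp
  ring

/-- Differentiating the weight yields exactly minus the connection term that this component meets in
`dirac_rows`. The right side keeps the table entries unsimplified so that they cancel literally,
leaving only the derivative of the radial factor. -/
lemma frame_one_component (hr : 0 < r) (hΔ : 0 < M.deltaR r)
    (hu : √(M.U r θ) = u) (hδ : √(M.deltaR r) = δ) (ε : ℝ) (hε : ε ^ 2 = 1) {ψ D : ℂ}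
    (hd : fderiv ℝ Ψ ![0, r, θ, 0] (Pi.single 1 1) j =
      D - (δ' / (2 * √(M.deltaR r)) + 1 / (2 * M.rootFactor ε r θ ^ 2)) * ψ) :
    (u : ℂ) * (fderiv ℝ Ψ ![0, r, θ, 0] (M.frame 1 ![0, r, θ, 0]) j +
      Complex.I * (M.potential ![0, r, θ, 0] (M.frame 1 ![0, r, θ, 0]) : ℂ) * ψ) =
      δ * D - u * ((((δ' / u - r * δ / u ^ 3 : ℝ) : ℂ) - ((-(δ * r / u ^ 3) : ℝ) : ℂ) -
        ((-(δ * r / u ^ 3) : ℝ) : ℂ)) / 2 -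
        ε * (Complex.I * (((2 * M.a * Real.cos θ * δ / u ^ 3 : ℝ) : ℂ) / 4))) * ψ := by
  have hd0 : (δ : ℂ) ≠ 0 := Complex.ofReal_ne_zero.2 (hδ ▸ (Real.sqrt_pos.2 hΔ).ne')
  have hu0 : (u : ℂ) ≠ 0 :=
    Complex.ofReal_ne_zero.2 (hu ▸ (Real.sqrt_pos.2 (M.U_pos hr θ)).ne')
  have h2 : 1 / (2 * M.rootFactor ε r θ ^ 2) = (1 / M.rootFactor ε r θ ^ 2) / 2 := by
    rw [div_div, mul_comm]
  rw [potential_frame_one, fderiv_apply_eq_sum,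
    Fin.sum_univ_four, hd, frame_one, h2, one_div_rootFactor_sq ε hε hr hu]
  simp [hu, hδ]
  field_simp
  ring

/-- As for the radial direction, but the weight removes only part of the connection; what remains is
`angularH`. -/
lemma frame_two_component (hr : 0 < r) (hs : 0 < Real.sin θ)
    (hu : √(M.U r θ) = u) (hτ : √(M.deltaTheta θ) = τ) (ε : ℝ) (hε : ε ^ 2 = 1) {ψ D : ℂ}
    (hd : fderiv ℝ Ψ ![0, r, θ, 0] (Pi.single 2 1) j =
      D + Complex.I * ε * M.a * Real.sin θ / (2 * M.rootFactor ε r θ ^ 2) * ψ) :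
    (u : ℂ) * (fderiv ℝ Ψ ![0, r, θ, 0] (M.frame 2 ![0, r, θ, 0]) j +
      Complex.I * (M.potential ![0, r, θ, 0] (M.frame 2 ![0, r, θ, 0]) : ℂ) * ψ) =
      τ * (D + M.angularH θ * ψ) -
        u * ((((-(τ * M.a ^ 2 * Real.cos θ * Real.sin θ / u ^ 3) : ℝ) : ℂ) +
        ((-(τ * M.a ^ 2 * Real.cos θ * Real.sin θ / u ^ 3) : ℝ) : ℂ) -
        ((-(M.κ ^ 2 * M.a ^ 2 * Real.cos θ * Real.sin θ / (τ * u) +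
        τ * M.a ^ 2 * Real.cos θ * Real.sin θ / u ^ 3 +
        τ * Real.cos θ / (u * Real.sin θ)) : ℝ) : ℂ)) / 2 -
        ε * (Complex.I * (((2 * M.a * r * Real.sin θ * τ / u ^ 3 : ℝ) : ℂ) / 4))) * ψ := by
  have ht0 : (τ : ℂ) ≠ 0 :=
    Complex.ofReal_ne_zero.2 (hτ ▸ (Real.sqrt_pos.2 (M.deltaTheta_pos θ)).ne')
  have hu0 : (u : ℂ) ≠ 0 :=
    Complex.ofReal_ne_zero.2 (hu ▸ (Real.sqrt_pos.2 (M.U_pos hr θ)).ne')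
  have hs0 : (Real.sin θ : ℂ) ≠ 0 := Complex.ofReal_ne_zero.2 hs.ne'
  have ht2 : M.deltaTheta θ = τ ^ 2 := by rw [← hτ, Real.sq_sqrt (M.deltaTheta_pos θ).le]
  have hε' : (ε : ℂ) ^ 2 = 1 := by exact_mod_cast hε
  have h2 (b : ℂ) : b / (2 * M.rootFactor ε r θ ^ 2) = b * (1 / M.rootFactor ε r θ ^ 2) / 2 := by
    ring
  rw [potential_frame_two, fderiv_apply_eq_sum,
    Fin.sum_univ_four, hd, frame_two, h2, one_div_rootFactor_sq ε hε hr hu, angularH,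
    Real.cot_eq_cos_div_sin, ht2]
  simp only [Matrix.cons_val, hu, hτ]
  push_cast at hs0 ⊢
  field_simp
  ring_nf
  linear_combination (-4 * τ ^ 2 * Complex.sin θ ^ 2 * M.a ^ 2 * Complex.cos θ * ψ) *
    (Complex.I ^ 2 * hε' + Complex.I_sq)

lemma frame_three_component (hr : 0 < r) (hs : 0 < Real.sin θ)
    (hu : √(M.U r θ) = u) (hτ : √(M.deltaTheta θ) = τ) {ψ : ℂ}
    (ht : fderiv ℝ Ψ ![0, r, θ, 0] (Pi.single 0 1) j = -Complex.I * ω * ψ)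
    (hp : fderiv ℝ Ψ ![0, r, θ, 0] (Pi.single 3 1) j = -Complex.I * (k + 1 / 2) * ψ) :
    (u : ℂ) * (fderiv ℝ Ψ ![0, r, θ, 0] (M.frame 3 ![0, r, θ, 0]) j +
      Complex.I * (M.potential ![0, r, θ, 0] (M.frame 3 ![0, r, θ, 0]) : ℂ) * ψ) =
      Complex.I * τ * M.angularW ω k θ * ψ := by
  have ht0 : (τ : ℂ) ≠ 0 :=
    Complex.ofReal_ne_zero.2 (hτ ▸ (Real.sqrt_pos.2 (M.deltaTheta_pos θ)).ne')
  have hu0 : (u : ℂ) ≠ 0 :=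
    Complex.ofReal_ne_zero.2 (hu ▸ (Real.sqrt_pos.2 (M.U_pos hr θ)).ne')
  have hs0 : (Real.sin θ : ℂ) ≠ 0 := Complex.ofReal_ne_zero.2 hs.ne'
  have ht2 : M.deltaTheta θ = τ ^ 2 := by rw [← hτ, Real.sq_sqrt (M.deltaTheta_pos θ).le]
  rw [potential_frame_three (x := ![0, r, θ, 0]) hr hs hu hτ, fderiv_apply_eq_sum,
    Fin.sum_univ_four, ht, hp, frame_three, angularW, Real.cot_eq_cos_div_sin, ht2]
  simp only [Matrix.cons_val, hu, hτ]
  push_cast at hs0 ⊢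
  field_simp
  ring

end Frame

lemma dirac_rows (Ψ : Coord → Spinor) {x : Coord} {c100 c103 c200 c121 c122 c133 c230 c233 : ℝ}
    (hc : (fun α β γ => M.structureCoeff α β γ x) =
      coeffTable c100 c103 c200 c121 c122 c133 c230 c233) {lam : ℝ} {F : Fin 4 → Fin 4 → ℂ}
    (hF : ∀ α j, fderiv ℝ Ψ x (M.frame α x) j +
      Complex.I * (M.potential x (M.frame α x) : ℂ) * Ψ x j = F α j)
    (h : M.dirac Ψ x + (Complex.I * (lam : ℂ)) • Ψ x = 0) :
    -F 0 2 - (F 1 2 + (((c100 - c122 - c133) / 2 + Complex.I * (c230 / 4))) * Ψ x 2) +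
      (F 2 3 + ((c200 + c121 - c233) / 2 + Complex.I * (c103 / 4)) * Ψ x 3) +
      Complex.I * F 3 3 + Complex.I * lam * Ψ x 0 = 0 ∧
    -F 0 3 + (F 1 3 + (((c100 - c122 - c133) / 2 + Complex.I * (c230 / 4))) * Ψ x 3) +
      (F 2 2 + ((c200 + c121 - c233) / 2 + Complex.I * (c103 / 4)) * Ψ x 2) -
      Complex.I * F 3 2 + Complex.I * lam * Ψ x 1 = 0 ∧
    -F 0 0 + (F 1 0 + (((c100 - c122 - c133) / 2 - Complex.I * (c230 / 4))) * Ψ x 0) -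
      (F 2 1 + ((c200 + c121 - c233) / 2 - Complex.I * (c103 / 4)) * Ψ x 1) -
      Complex.I * F 3 1 + Complex.I * lam * Ψ x 2 = 0 ∧
    -F 0 1 - (F 1 1 + (((c100 - c122 - c133) / 2 - Complex.I * (c230 / 4))) * Ψ x 1) -
      (F 2 0 + ((c200 + c121 - c233) / 2 - Complex.I * (c103 / 4)) * Ψ x 0) +
      Complex.I * F 3 0 + Complex.I * lam * Ψ x 3 = 0 := by
  rw [dirac_eq_sub] at h
  have h2 := sum_clifford_coeffTable hc (Ψ x)
  rw [h2] at h
  have hF' (α) : fderiv ℝ Ψ x (M.frame α x) +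
      (Complex.I * (M.potential x (M.frame α x) : ℂ)) • Ψ x = F α :=
    funext fun j => hF α j
  simp only [hF', Fin.sum_univ_four, clifford_zero_mulVec, clifford_one_mulVec,
    clifford_two_mulVec, clifford_three_mulVec] at h
  refine ⟨?_, ?_, ?_, ?_⟩
  · have := congrFun h 0
    simp at this
    linear_combination this
  · have := congrFun h 1
    simp at this
    linear_combination this
  · have := congrFun h 2
    simp at this
    linear_combination this
  · have := congrFun h 3
    simp at this
    linear_combination this

/-! ### Assembling the rows into a separated system -/

section System

variable {re lam ω : ℝ} {k : ℤ} {Xp Xm Yp Ym : ℝ → ℂ} {Ψ : Coord → Spinor}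

/-- The mass term carries the opposite weight from the rest of its row. After multiplication by `√U`
this relation exchanges the weights and splits `iλ` into a radial part `iλr` and an angular part
`±aλ cos θ`. -/
lemma rootFactor_inv_relation (ε : ℝ) (hε : ε ^ 2 = 1) {r θ : ℝ} (hr : 0 < r) (d : ℂ) :
    (√(M.U r θ) : ℂ) * (d * M.rootFactor ε r θ)⁻¹ =
      (r - Complex.I * ε * M.a * Real.cos θ) * (d * M.rootFactor (-ε) r θ)⁻¹ := by
  have hz := M.rootFactor_ne_zero ε θ hr
  have hz' := M.rootFactor_ne_zero (-ε) θ hr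
  have hmul : M.rootFactor ε r θ * M.rootFactor (-ε) r θ = √(M.U r θ) := by
    rcases eq_or_eq_neg_of_sq_eq_sq ε 1 (by rw [hε, one_pow]) with rfl | rfl
    · exact rootFactor_mul θ hr
    · rw [mul_comm, neg_neg]
      exact rootFactor_mul θ hr
  have hsq := M.rootFactor_sq (-ε) r θ
  have h2 : (r - Complex.I * ε * M.a * Real.cos θ : ℂ) = M.rootFactor (-ε) r θ ^ 2 := by
    rw [hsq]
    push_cast
    ring
  rw [h2, ← hmul]
  by_cases hd : d = 0
  · simp [hd]
  · field_simp

/-- The Dirac equation for a separated spinor field, as four scalar equations. -/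
lemma separated_system (hre : M.IsExtreme re)
    (hform : ∀ x ∈ exterior re, Ψ x = M.separated ω k Xp Xm Yp Ym x)
    (hsol : M.IsDiracSolution re lam Ψ) {r θ : ℝ} (hr : re < r) (hθ : 0 < θ) (hθ' : θ < Real.pi)
    {Xp' Xm' Yp' Ym' : ℂ} (hXp : HasDerivAt Xp Xp' r) (hXm : HasDerivAt Xm Xm' r)
    (hYp : HasDerivAt Yp Yp' θ) (hYm : HasDerivAt Ym Ym' θ) {ρp ρm τp τm : ℂ}
    (hρp : ρp = √(M.deltaR r) * Xp' - Complex.I * M.radialK ω k r / √(M.deltaR r) * Xp r -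
      Complex.I * lam * r * Xm r)
    (hρm : ρm = √(M.deltaR r) * Xm' + Complex.I * M.radialK ω k r / √(M.deltaR r) * Xm r +
      Complex.I * lam * r * Xp r)
    (hτp : τp = M.a * lam * Real.cos θ * Ym θ +
      √(M.deltaTheta θ) * (Yp' - M.angularW ω k θ * Yp θ + M.angularH θ * Yp θ))
    (hτm : τm = -(√(M.deltaTheta θ) * (Ym' + M.angularW ω k θ * Ym θ + M.angularH θ * Ym θ)) -
      M.a * lam * Real.cos θ * Yp θ) :
    ρp * Ym θ = Xm r * τp ∧ ρp * Yp θ = Xm r * τm ∧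
      ρm * Ym θ = Xp r * τp ∧ ρm * Yp θ = Xp r * τm := by
  have hx : (![0, r, θ, 0] : Coord) ∈ exterior re := ⟨hr, hθ, hθ'⟩
  obtain ⟨hdiff, heq⟩ := hsol _ hx
  have hr0 : 0 < r := hre.1.trans hr
  have hΔ := hre.deltaR_pos hr
  have hs := Real.sin_pos_of_pos_of_lt_pi hθ hθ'
  have hδ' := hasDerivAt_sqrt_deltaR hΔ
  -- The exterior is open, so `Ψ` may be replaced by the separated form under the derivative. Points
  -- with `t = φ = 0` suffice, since the remaining dependence is a phase.
  have hev : Ψ =ᶠ[nhds ![0, r, θ, 0]] M.separated ω k Xp Xm Yp Ym := by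
    filter_upwards [(isOpen_exterior re).mem_nhds hx] with y hy using hform y hy
  have hsd : DifferentiableAt ℝ (M.separated ω k Xp Xm Yp Ym) ![0, r, θ, 0] :=
    hdiff.congr_of_eventuallyEq hev.symm
  have hfd := hev.fderiv_eq (𝕜 := ℝ)
  have hT (j) := hasDerivAt_line hsd (hasDerivAt_line_t r θ) rfl j
  have hR (j) := hasDerivAt_line hsd (hasDerivAt_line_r r θ) rfl j
  have hΘ (j) := hasDerivAt_line hsd (hasDerivAt_line_theta r θ) rfl j
  have hΦ (j) := hasDerivAt_line hsd (hasDerivAt_line_phi r θ) rfl j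
  rw [← hfd] at hT hR hΘ hΦ
  rw [separated_eq] at hT hR hΘ hΦ
  have hv := hform _ hx
  rw [separated_eq] at hv
  have hv0 : Ψ ![0, r, θ, 0] 0 = M.sepComponent ω k 1 Xm Ym ![0, r, θ, 0] := by rw [hv]; rfl
  have hv1 : Ψ ![0, r, θ, 0] 1 = M.sepComponent ω k 1 Xp Yp ![0, r, θ, 0] := by rw [hv]; rfl
  have hv2 : Ψ ![0, r, θ, 0] 2 = M.sepComponent ω k (-1) Xp Ym ![0, r, θ, 0] := by rw [hv]; rfl
  have hv3 : Ψ ![0, r, θ, 0] 3 = M.sepComponent ω k (-1) Xm Yp ![0, r, θ, 0] := by rw [hv]; rfl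
  have o1 : (1 : ℝ) ^ 2 = 1 := one_pow 2
  have o2 : (-1 : ℝ) ^ 2 = 1 := by norm_num
  have hE0 {j} {ε : ℝ} {X Y : ℝ → ℂ} := frame_zero_component (Ψ := Ψ) (j := j) (k := k) (ω := ω)
    (ψ := M.sepComponent ω k ε X Y ![0, r, θ, 0]) hr0 hΔ (θ := θ) rfl rfl
  have hE3 {j} {ε : ℝ} {X Y : ℝ → ℂ} := frame_three_component (M := M) (Ψ := Ψ) (j := j) (k := k)
    (ω := ω) (ψ := M.sepComponent ω k ε X Y ![0, r, θ, 0]) hr0 hs rfl rfl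
  have a0 := hE0 ((hT 0).unique (hasDerivAt_sepComponent_t r θ))
    ((hΦ 0).unique (hasDerivAt_sepComponent_phi r θ))
  have a1 := hE0 ((hT 1).unique (hasDerivAt_sepComponent_t r θ))
    ((hΦ 1).unique (hasDerivAt_sepComponent_phi r θ))
  have a2 := hE0 ((hT 2).unique (hasDerivAt_sepComponent_t r θ))
    ((hΦ 2).unique (hasDerivAt_sepComponent_phi r θ))
  have a3 := hE0 ((hT 3).unique (hasDerivAt_sepComponent_t r θ))
    ((hΦ 3).unique (hasDerivAt_sepComponent_phi r θ))
  have d0 := hE3 ((hT 0).unique (hasDerivAt_sepComponent_t r θ))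
    ((hΦ 0).unique (hasDerivAt_sepComponent_phi r θ))
  have d1 := hE3 ((hT 1).unique (hasDerivAt_sepComponent_t r θ))
    ((hΦ 1).unique (hasDerivAt_sepComponent_phi r θ))
  have d2 := hE3 ((hT 2).unique (hasDerivAt_sepComponent_t r θ))
    ((hΦ 2).unique (hasDerivAt_sepComponent_phi r θ))
  have d3 := hE3 ((hT 3).unique (hasDerivAt_sepComponent_t r θ))
    ((hΦ 3).unique (hasDerivAt_sepComponent_phi r θ))
  have b0 := frame_one_component hr0 hΔ rfl rfl 1 o1
    ((hR 0).unique (hasDerivAt_sepComponent_r hr0 hΔ hδ' hXm θ))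
  have b1 := frame_one_component hr0 hΔ rfl rfl 1 o1
    ((hR 1).unique (hasDerivAt_sepComponent_r hr0 hΔ hδ' hXp θ))
  have b2 := frame_one_component hr0 hΔ rfl rfl (-1) o2
    ((hR 2).unique (hasDerivAt_sepComponent_r hr0 hΔ hδ' hXp θ))
  have b3 := frame_one_component hr0 hΔ rfl rfl (-1) o2
    ((hR 3).unique (hasDerivAt_sepComponent_r hr0 hΔ hδ' hXm θ))
  have c0 := frame_two_component hr0 hs rfl rfl 1 o1
    ((hΘ 0).unique (hasDerivAt_sepComponent_theta hr0 hΔ hYm))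
  have c1 := frame_two_component hr0 hs rfl rfl 1 o1
    ((hΘ 1).unique (hasDerivAt_sepComponent_theta hr0 hΔ hYp))
  have c2 := frame_two_component hr0 hs rfl rfl (-1) o2
    ((hΘ 2).unique (hasDerivAt_sepComponent_theta hr0 hΔ hYm))
  have c3 := frame_two_component hr0 hs rfl rfl (-1) o2
    ((hΘ 3).unique (hasDerivAt_sepComponent_theta hr0 hΔ hYp))
  rw [← hv0] at a0 b0 c0 d0
  rw [← hv1] at a1 b1 c1 d1
  rw [← hv2] at a2 b2 c2 d2
  rw [← hv3] at a3 b3 c3 d3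
  have htab := structureCoeff_eq_coeffTable (x := ![0, r, θ, 0]) hr0 hΔ hs hδ' rfl rfl rfl
  obtain ⟨e0, e1, e2, e3⟩ := dirac_rows Ψ htab (fun α j => rfl) heq
  obtain ⟨F, hF⟩ : ∃ F : Fin 4 → Fin 4 → ℂ, ∀ α j,
      fderiv ℝ Ψ ![0, r, θ, 0] (M.frame α ![0, r, θ, 0]) j + Complex.I *
        (M.potential ![0, r, θ, 0] (M.frame α ![0, r, θ, 0]) : ℂ) * Ψ ![0, r, θ, 0] j = F α j :=
    ⟨_, fun _ _ => rfl⟩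
  simp only [hF] at a0 a1 a2 a3 b0 b1 b2 b3 c0 c1 c2 c3 d0 d1 d2 d3 e0 e1 e2 e3
  rw [sepComponent_slice] at hv0 hv1 hv2 hv3
  have r1 := rootFactor_inv_relation (M := M) 1 o1 (θ := θ) hr0 ((M.deltaR r ^ (1 / 4 : ℝ) : ℝ) : ℂ)
  have r2 := rootFactor_inv_relation (M := M) (-1) o2 (θ := θ) hr0
    ((M.deltaR r ^ (1 / 4 : ℝ) : ℝ) : ℂ)
  have hq1 : (((M.deltaR r ^ (1 / 4 : ℝ) : ℝ) : ℂ) * M.rootFactor 1 r θ)⁻¹ ≠ 0 :=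
    inv_ne_zero (mul_ne_zero (quarter_ne_zero hΔ) (M.rootFactor_ne_zero 1 θ hr0))
  have hq2 : (((M.deltaR r ^ (1 / 4 : ℝ) : ℝ) : ℂ) * M.rootFactor (-1) r θ)⁻¹ ≠ 0 :=
    inv_ne_zero (mul_ne_zero (quarter_ne_zero hΔ) (M.rootFactor_ne_zero (-1) θ hr0))
  rw [neg_neg] at r2
  generalize (((M.deltaR r ^ (1 / 4 : ℝ) : ℝ) : ℂ) * M.rootFactor 1 r θ)⁻¹ = q at *
  generalize (((M.deltaR r ^ (1 / 4 : ℝ) : ℝ) : ℂ) * M.rootFactor (-1) r θ)⁻¹ = q' at *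
  simp only [hv0, hv1, hv2, hv3, Matrix.cons_val] at a0 a1 a2 a3 b0 b1 b2 b3 c0 c1 c2 c3
  simp only [hv0, hv1, hv2, hv3, Matrix.cons_val] at d0 d1 d2 d3 e0 e1 e2 e3
  clear hv0 hv1 hv2 hv3 hF hT hR hΘ hΦ hE0 hE3 htab hfd hev hsd hdiff heq hv
  subst hρp hρm hτp hτm
  push_cast at *
  generalize (√(M.U r θ) : ℂ) = u at *
  -- Each identity is one row of the Dirac equation times `±√U`; `r1` or `r2` brings the mass term
  -- to the common weight `q` or `q'`, which is then cancelled.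
  refine ⟨mul_left_cancel₀ hq2 ?_, mul_left_cancel₀ hq1 ?_, mul_left_cancel₀ hq1 ?_,
    mul_left_cancel₀ hq2 ?_⟩
  · linear_combination (-u) * e0 - a2 - b2 + c3 + Complex.I * d3 +
      Complex.I * lam * (Xm r * Ym θ) * r1 +
        q' * Xm r * (√(M.deltaTheta θ) * M.angularW ω k θ * Yp θ -
          lam * M.a * Complex.cos θ * Ym θ) * Complex.I_sq
  · linear_combination (-u) * e3 - a1 - b1 - c0 + Complex.I * d0 +
      Complex.I * lam * (Xm r * Yp θ) * r2 +
        q * Xm r * (√(M.deltaTheta θ) * M.angularW ω k θ * Ym θ +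
          lam * M.a * Complex.cos θ * Yp θ) * Complex.I_sq
  · linear_combination u * e2 + a0 - b0 + c1 + Complex.I * d1 -
      Complex.I * lam * (Xp r * Ym θ) * r2 +
        q * Xp r * (√(M.deltaTheta θ) * M.angularW ω k θ * Yp θ -
          lam * M.a * Complex.cos θ * Ym θ) * Complex.I_sq
  · linear_combination u * e1 + a3 - b3 - c2 + Complex.I * d2 -
      Complex.I * lam * (Xp r * Yp θ) * r1 +
        q' * Xp r * (√(M.deltaTheta θ) * M.angularW ω k θ * Ym θ +
          lam * M.a * Complex.cos θ * Yp θ) * Complex.I_sq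

end System

/-! ### Separation of variables -/

section Separation

variable {re lam ω : ℝ} {k : ℤ} {Xp Xm Yp Ym : ℝ → ℂ} {Ψ : Coord → Spinor}

lemma sepComponent_ne_zero {ε : ℝ} {X Y : ℝ → ℂ} {x : Coord}
    (h : M.sepComponent ω k ε X Y x ≠ 0) : X (x 1) ≠ 0 ∧ Y (x 2) ≠ 0 := by
  constructor <;> intro h0 <;> simp [sepComponent, h0] at h

/-- Only `Ψ` is assumed differentiable. The factor is recovered on a radial line by multiplying a
component by the smooth weight and dividing by a nonzero value of `Y`. -/
lemma differentiableAt_radial_factor (hre : M.IsExtreme re) {j : Fin 4} {ε : ℝ} {X Y : ℝ → ℂ}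
    (hΨ : ∀ x ∈ exterior re, DifferentiableAt ℝ Ψ x)
    (hj : ∀ x ∈ exterior re, Ψ x j = M.sepComponent ω k ε X Y x)
    {r θ : ℝ} (hr : re < r) (hθ : 0 < θ) (hθ' : θ < Real.pi) (hY : Y θ ≠ 0) :
    DifferentiableAt ℝ X r := by
  have h1 := (hasDerivAt_line (hΨ ![0, r, θ, 0] ⟨hr, hθ, hθ'⟩) (hasDerivAt_line_r r θ)
    rfl j).differentiableAt
  have h2 := (hasDerivAt_rpow_quarter (hre.deltaR_pos hr)
    (hasDerivAt_sqrt_deltaR (hre.deltaR_pos hr))).differentiableAt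
  have h3 := (hasDerivAt_rootFactor_left (M := M) ε θ (hre.1.trans hr)).differentiableAt
  refine ((h1.mul (h2.mul h3)).mul_const (Y θ)⁻¹).congr_of_eventuallyEq ?_
  filter_upwards [lt_mem_nhds hr] with s hs
  have hd := quarter_ne_zero (hre.deltaR_pos hs)
  have hz := M.rootFactor_ne_zero ε θ (hre.1.trans hs)
  simp only [Pi.mul_apply]
  rw [hj _ ⟨hs, hθ, hθ'⟩, sepComponent_slice]
  generalize ((M.deltaR s ^ (1 / 4 : ℝ) : ℝ) : ℂ) = d at *
  field_simp

lemma differentiableAt_angular_factor (hre : M.IsExtreme re) {j : Fin 4} {ε : ℝ} {X Y : ℝ → ℂ}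
    (hΨ : ∀ x ∈ exterior re, DifferentiableAt ℝ Ψ x)
    (hj : ∀ x ∈ exterior re, Ψ x j = M.sepComponent ω k ε X Y x)
    {r θ : ℝ} (hr : re < r) (hθ : 0 < θ) (hθ' : θ < Real.pi) (hX : X r ≠ 0) :
    DifferentiableAt ℝ Y θ := by
  have h1 := (hasDerivAt_line (hΨ ![0, r, θ, 0] ⟨hr, hθ, hθ'⟩) (hasDerivAt_line_theta r θ)
    rfl j).differentiableAt
  have h3 := (hasDerivAt_rootFactor_right (M := M) ε θ (hre.1.trans hr)).differentiableAt
  refine ((h1.mul (h3.const_mul ((M.deltaR r ^ (1 / 4 : ℝ) : ℝ) : ℂ))).mul_const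
    (X r)⁻¹).congr_of_eventuallyEq ?_
  filter_upwards [lt_mem_nhds hθ, gt_mem_nhds hθ'] with s hs hs'
  have hd := quarter_ne_zero (hre.deltaR_pos hr)
  have hz := M.rootFactor_ne_zero ε s (hre.1.trans hr)
  simp only [Pi.mul_apply]
  rw [hj _ ⟨hr, hs, hs'⟩, sepComponent_slice]
  generalize ((M.deltaR r ^ (1 / 4 : ℝ) : ℝ) : ℂ) = d at *
  field_simp

lemma components_eq (hform : ∀ x ∈ exterior re, Ψ x = M.separated ω k Xp Xm Yp Ym x) :
    (∀ x ∈ exterior re, Ψ x 0 = M.sepComponent ω k 1 Xm Ym x) ∧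
    (∀ x ∈ exterior re, Ψ x 1 = M.sepComponent ω k 1 Xp Yp x) ∧
    (∀ x ∈ exterior re, Ψ x 2 = M.sepComponent ω k (-1) Xp Ym x) ∧
    (∀ x ∈ exterior re, Ψ x 3 = M.sepComponent ω k (-1) Xm Yp x) := by
  rw [separated_eq] at hform
  refine ⟨?_, ?_, ?_, ?_⟩ <;> intro x hx <;> rw [hform x hx] <;> rfl

lemma exists_factor_ne_zero
    (hform : ∀ x ∈ exterior re, Ψ x = M.separated ω k Xp Xm Yp Ym x)
    (hnontrivial : ∃ x ∈ exterior re, Ψ x ≠ 0) :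
    (∃ r, re < r ∧ (Xp r ≠ 0 ∨ Xm r ≠ 0)) ∧
      ∃ θ, 0 < θ ∧ θ < Real.pi ∧ (Yp θ ≠ 0 ∨ Ym θ ≠ 0) := by
  obtain ⟨x, hx, hne⟩ := hnontrivial
  obtain ⟨h0, h1, h2, h3⟩ := components_eq hform
  obtain ⟨j, hj⟩ := Function.ne_iff.1 hne
  fin_cases j
  · obtain ⟨a, b⟩ := sepComponent_ne_zero (h0 x hx ▸ hj)
    exact ⟨⟨_, hx.1, Or.inr a⟩, _, hx.2.1, hx.2.2, Or.inr b⟩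
  · obtain ⟨a, b⟩ := sepComponent_ne_zero (h1 x hx ▸ hj)
    exact ⟨⟨_, hx.1, Or.inl a⟩, _, hx.2.1, hx.2.2, Or.inl b⟩
  · obtain ⟨a, b⟩ := sepComponent_ne_zero (h2 x hx ▸ hj)
    exact ⟨⟨_, hx.1, Or.inl a⟩, _, hx.2.1, hx.2.2, Or.inr b⟩
  · obtain ⟨a, b⟩ := sepComponent_ne_zero (h3 x hx ▸ hj)
    exact ⟨⟨_, hx.1, Or.inr a⟩, _, hx.2.1, hx.2.2, Or.inl b⟩

lemma differentiableAt_factors (hre : M.IsExtreme re)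
    (hform : ∀ x ∈ exterior re, Ψ x = M.separated ω k Xp Xm Yp Ym x)
    (hΨ : ∀ x ∈ exterior re, DifferentiableAt ℝ Ψ x)
    (hnontrivial : ∃ x ∈ exterior re, Ψ x ≠ 0) :
    (∀ r, re < r → DifferentiableAt ℝ Xp r ∧ DifferentiableAt ℝ Xm r) ∧
      ∀ θ, 0 < θ → θ < Real.pi → DifferentiableAt ℝ Yp θ ∧ DifferentiableAt ℝ Ym θ := by
  obtain ⟨h0, h1, h2, h3⟩ := components_eq hform
  obtain ⟨⟨r₀, hr₀, hX⟩, θ₀, hθ₀, hθ₀', hY⟩ := exists_factor_ne_zero hform hnontrivial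
  constructor
  · intro r hr
    rcases hY with hY | hY
    · exact ⟨differentiableAt_radial_factor hre hΨ h1 hr hθ₀ hθ₀' hY,
        differentiableAt_radial_factor hre hΨ h3 hr hθ₀ hθ₀' hY⟩
    · exact ⟨differentiableAt_radial_factor hre hΨ h2 hr hθ₀ hθ₀' hY,
        differentiableAt_radial_factor hre hΨ h0 hr hθ₀ hθ₀' hY⟩
  · intro θ hθ hθ'
    rcases hX with hX | hX
    · exact ⟨differentiableAt_angular_factor hre hΨ h1 hr₀ hθ hθ' hX,
        differentiableAt_angular_factor hre hΨ h2 hr₀ hθ hθ' hX⟩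
    · exact ⟨differentiableAt_angular_factor hre hΨ h3 hr₀ hθ hθ' hX,
        differentiableAt_angular_factor hre hΨ h0 hr₀ hθ hθ' hX⟩

/-- A separated solution of the Dirac equation has exactly one separation constant. -/
lemma exists_separationConstant (hre : M.IsExtreme re)
    (hform : ∀ x ∈ exterior re, Ψ x = M.separated ω k Xp Xm Yp Ym x)
    (hsol : M.IsDiracSolution re lam Ψ) (hnontrivial : ∃ x ∈ exterior re, Ψ x ≠ 0) :
    ∃ η : ℂ, ∀ η' : ℂ, M.IsSeparationConstant re lam ω k Xp Xm Yp Ym η' ↔ η' = η := by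
  obtain ⟨hdX, hdY⟩ := differentiableAt_factors hre hform (fun x hx => (hsol x hx).1) hnontrivial
  obtain ⟨⟨r₀, hr₀, hX⟩, θ₀, hθ₀, hθ₀', hY⟩ := exists_factor_ne_zero hform hnontrivial
  obtain ⟨ρp, hρp⟩ : ∃ ρp : ℝ → ℂ, ∀ r, ρp r = √(M.deltaR r) * deriv Xp r -
      Complex.I * M.radialK ω k r / √(M.deltaR r) * Xp r - Complex.I * lam * r * Xm r :=
    ⟨_, fun _ => rfl⟩
  obtain ⟨ρm, hρm⟩ : ∃ ρm : ℝ → ℂ, ∀ r, ρm r = √(M.deltaR r) * deriv Xm r +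
      Complex.I * M.radialK ω k r / √(M.deltaR r) * Xm r + Complex.I * lam * r * Xp r :=
    ⟨_, fun _ => rfl⟩
  obtain ⟨τp, hτp⟩ : ∃ τp : ℝ → ℂ, ∀ θ, τp θ = M.a * lam * Real.cos θ * Ym θ +
      √(M.deltaTheta θ) * (deriv Yp θ - M.angularW ω k θ * Yp θ + M.angularH θ * Yp θ) :=
    ⟨_, fun _ => rfl⟩
  obtain ⟨τm, hτm⟩ : ∃ τm : ℝ → ℂ, ∀ θ, τm θ = -(√(M.deltaTheta θ) *
      (deriv Ym θ + M.angularW ω k θ * Ym θ + M.angularH θ * Ym θ)) -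
      M.a * lam * Real.cos θ * Yp θ :=
    ⟨_, fun _ => rfl⟩
  have key : ∀ r, re < r → ∀ θ, 0 < θ → θ < Real.pi →
      ρp r * Ym θ = Xm r * τp θ ∧ ρp r * Yp θ = Xm r * τm θ ∧
      ρm r * Ym θ = Xp r * τp θ ∧ ρm r * Yp θ = Xp r * τm θ := fun r hr θ hθ hθ' =>
    separated_system hre hform hsol hr hθ hθ' (hdX r hr).1.hasDerivAt (hdX r hr).2.hasDerivAt
      (hdY θ hθ hθ').1.hasDerivAt (hdY θ hθ hθ').2.hasDerivAt (hρp r) (hρm r) (hτp θ) (hτm θ)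
  -- Freezing `θ` at a point where some angular factor is nonzero defines `η` as a quotient there,
  -- valid for all `r`.
  have hrad : ∃ η : ℂ, ∀ r, re < r → ρp r = η * Xm r ∧ ρm r = η * Xp r := by
    rcases hY with hY | hY
    · refine ⟨τm θ₀ / Yp θ₀, fun r hr => ?_⟩
      obtain ⟨-, h2, -, h4⟩ := key r hr θ₀ hθ₀ hθ₀'
      constructor
      · field_simp
        linear_combination h2
      · field_simp
        linear_combination h4
    · refine ⟨τp θ₀ / Ym θ₀, fun r hr => ?_⟩
      obtain ⟨h1, -, h3, -⟩ := key r hr θ₀ hθ₀ hθ₀'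
      constructor
      · field_simp
        linear_combination h1
      · field_simp
        linear_combination h3
  obtain ⟨η, hη⟩ := hrad
  -- Freezing `r` where some radial factor is nonzero transfers the same `η` to the angular side.
  have hang : ∀ θ, 0 < θ → θ < Real.pi → τp θ = η * Ym θ ∧ τm θ = η * Yp θ := by
    intro θ hθ hθ'
    obtain ⟨h1, h2, h3, h4⟩ := key r₀ hr₀ θ hθ hθ'
    rw [(hη r₀ hr₀).1] at h1 h2
    rw [(hη r₀ hr₀).2] at h3 h4
    rcases hX with hX | hX
    · exact ⟨mul_left_cancel₀ hX (by linear_combination -h3),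
        mul_left_cancel₀ hX (by linear_combination -h4)⟩
    · exact ⟨mul_left_cancel₀ hX (by linear_combination -h1),
        mul_left_cancel₀ hX (by linear_combination -h2)⟩
  refine ⟨η, fun η' => ⟨fun h => ?_, ?_⟩⟩
  · obtain ⟨-, -, h1, h2⟩ := h.2 θ₀ hθ₀ hθ₀'
    obtain ⟨g1, g2⟩ := hang θ₀ hθ₀ hθ₀'
    rw [hτp] at g1
    rw [hτm] at g2
    push_cast at h1 h2 g1 g2
    rcases hY with hY | hY
    · exact mul_right_cancel₀ hY (by linear_combination g2 - h2)
    · exact mul_right_cancel₀ hY (by linear_combination g1 - h1)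
  · rintro rfl
    refine ⟨fun r hr => ⟨(hdX r hr).1, (hdX r hr).2, ?_, ?_⟩,
      fun θ hθ hθ' => ⟨(hdY θ hθ hθ').1, (hdY θ hθ hθ').2, ?_, ?_⟩⟩
    · have hΔ := hre.deltaR_pos hr
      have hd : (√(M.deltaR r) : ℂ) ≠ 0 := Complex.ofReal_ne_zero.2 (Real.sqrt_pos.2 hΔ).ne'
      have h2 : (M.deltaR r : ℂ) = (√(M.deltaR r) : ℂ) ^ 2 := by
        rw [← Complex.ofReal_pow, Real.sq_sqrt hΔ.le]
      have h := (hη r hr).1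
      rw [hρp] at h
      rw [h2]
      field_simp at h ⊢
      linear_combination h
    · have hΔ := hre.deltaR_pos hr
      have hd : (√(M.deltaR r) : ℂ) ≠ 0 := Complex.ofReal_ne_zero.2 (Real.sqrt_pos.2 hΔ).ne'
      have h2 : (M.deltaR r : ℂ) = (√(M.deltaR r) : ℂ) ^ 2 := by
        rw [← Complex.ofReal_pow, Real.sq_sqrt hΔ.le]
      have h := (hη r hr).2
      rw [hρm] at h
      rw [h2]
      field_simp at h ⊢
      linear_combination h
    · have h := (hang θ hθ hθ').1
      rw [hτp] at h
      push_cast at h ⊢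
      linear_combination h
    · have h := (hang θ hθ hθ').2
      rw [hτm] at h
      push_cast at h ⊢
      linear_combination h

end Separation

/-! ### The separation constant is real -/

section Angular

variable {re lam ω : ℝ} {k : ℤ} {Xp Xm Yp Ym : ℝ → ℂ} {Ψ : Coord → Spinor}

lemma norm_rootFactor_sq_le (ε : ℝ) (hε : ε ^ 2 = 1) (r θ : ℝ) :
    ‖M.rootFactor ε r θ‖ ^ 2 ≤ |r| + |M.a| := by
  rw [← norm_pow, rootFactor_sq]
  refine (norm_add_le _ _).trans (add_le_add (by simp) ?_)
  have h1 : |ε| = 1 := (pow_eq_one_iff_of_nonneg (abs_nonneg _) two_ne_zero).1 (by rw [sq_abs, hε])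
  rw [norm_mul, Complex.norm_I, one_mul, Complex.norm_real, Real.norm_eq_abs, abs_mul, abs_mul,
    h1, one_mul]
  exact mul_le_of_le_one_right (abs_nonneg _) (Real.abs_cos_le_one θ)

/-- A closed meridian at fixed `r` is compact and includes the poles, so `Ψ` is bounded on its open
part. The weight is bounded there too, and `X r` is a nonzero constant. -/
lemma bounded_angular_factor (hre : M.IsExtreme re) {j : Fin 4} {ε : ℝ} (hε : ε ^ 2 = 1)
    {X Y : ℝ → ℂ} (hj : ∀ x ∈ exterior re, Ψ x j = M.sepComponent ω k ε X Y x)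
    (haxis : LocallyBoundedAtAxis re Ψ) {r : ℝ} (hr : re < r) (hX : X r ≠ 0) :
    ∃ C, ∀ θ, 0 < θ → θ < Real.pi → ‖Y θ‖ ≤ C := by
  have hcont : Continuous fun θ : ℝ => (![0, r, θ, 0] : Coord) :=
    continuous_iff_continuousAt.2 fun θ => (hasDerivAt_line_theta r θ).continuousAt
  have hK := haxis ((fun θ : ℝ => (![0, r, θ, 0] : Coord)) '' Set.Icc 0 Real.pi)
    (isCompact_Icc.image hcont) (by rintro _ ⟨θ, -, rfl⟩; exact hr)
  obtain ⟨C, hC⟩ := hK.exists_norm_le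
  have hd := quarter_ne_zero (hre.deltaR_pos hr)
  set d := ((M.deltaR r ^ (1 / 4 : ℝ) : ℝ) : ℂ) with hd_def
  refine ⟨C * (‖d‖ * (1 + (|r| + |M.a|))) / ‖X r‖, fun θ hθ hθ' => ?_⟩
  have hx : (![0, r, θ, 0] : Coord) ∈ exterior re := ⟨hr, hθ, hθ'⟩
  have h1 : ‖Ψ ![0, r, θ, 0] j‖ ≤ C := (norm_le_pi_norm _ j).trans
    (hC _ ⟨_, ⟨⟨θ, ⟨hθ.le, hθ'.le⟩, rfl⟩, hx⟩, rfl⟩)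
  have hz := M.rootFactor_ne_zero ε θ (hre.1.trans hr)
  have h2 : Y θ = Ψ ![0, r, θ, 0] j * (d * M.rootFactor ε r θ) / X r := by
    rw [hj _ hx, sepComponent_slice, ← hd_def]
    field_simp
  have h3 : ‖M.rootFactor ε r θ‖ ≤ 1 + (|r| + |M.a|) := by
    nlinarith [norm_rootFactor_sq_le (M := M) ε hε r θ, sq_nonneg (‖M.rootFactor ε r θ‖ - 1)]
  rw [h2, norm_div, norm_mul, norm_mul]
  gcongr
  exact (norm_nonneg _).trans h1

/-- This is the Lagrange identity for the angular system. The `angularW` terms cancel by their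
opposite signs, the weight `sin θ √Δ₋(θ)` has logarithmic derivative `2 * angularH`, and the `aλ cos
θ` terms are real; only `Im η` is left. -/
lemma hasDerivAt_angular_form {η : ℂ} (h : M.AngularEq lam ω k η Yp Ym) {θ : ℝ} (hθ : 0 < θ)
    (hθ' : θ < Real.pi) :
    HasDerivAt (fun y => Real.sin y * √(M.deltaTheta y) * (Yp y * (starRingEnd ℂ) (Ym y)).im)
      (Real.sin θ * (η.im * (‖Yp θ‖ ^ 2 + ‖Ym θ‖ ^ 2))) θ := by
  obtain ⟨dp, dm, h1, h2⟩ := h θ hθ hθ'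
  have hs := (Real.sin_pos_of_pos_of_lt_pi hθ hθ').ne'
  have ht := (Real.sqrt_pos.2 (M.deltaTheta_pos θ)).ne'
  have ht2 := Real.sq_sqrt (M.deltaTheta_pos θ).le
  have hw := (Real.hasDerivAt_sin θ).mul (M.hasDerivAt_sqrt_deltaTheta θ)
  have hp : HasDerivAt (fun y => (Yp y * (starRingEnd ℂ) (Ym y)).im)
      (deriv Yp θ * (starRingEnd ℂ) (Ym θ) + Yp θ * (starRingEnd ℂ) (deriv Ym θ)).im θ :=
    Complex.imCLM.hasFDerivAt.comp_hasDerivAt θ (dp.hasDerivAt.mul dm.hasDerivAt.star)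
  refine (hw.mul hp).congr_deriv ?_
  simp only [Complex.ext_iff, Complex.add_re, Complex.add_im, Complex.mul_re, Complex.mul_im,
    Complex.sub_re, Complex.sub_im, Complex.ofReal_re, Complex.ofReal_im, Complex.neg_re,
    Complex.neg_im, Complex.conj_re, Complex.conj_im, zero_mul, sub_zero, add_zero] at h1 h2 ⊢
  obtain ⟨a1, a2⟩ := h1
  obtain ⟨b1, b2⟩ := h2
  have hH : M.angularH θ = (Real.cos θ / Real.sin θ +
    M.κ ^ 2 * M.a ^ 2 * Real.sin θ * Real.cos θ / √(M.deltaTheta θ) ^ 2) / 2 := by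
    rw [angularH, Real.cot_eq_cos_div_sin, ht2]
  rw [hH] at a1 a2 b1 b2
  rw [← Complex.normSq_eq_norm_sq, ← Complex.normSq_eq_norm_sq, Complex.normSq_apply,
    Complex.normSq_apply]
  simp only [Pi.mul_apply]
  generalize √(M.deltaTheta θ) = τ at *
  generalize M.angularW ω k θ = W at *
  field_simp at a1 a2 b1 b2 ⊢
  linear_combination ((Ym θ).re * a2 - (Ym θ).im * a1 + (Yp θ).re * b2 - (Yp θ).im * b1) / 2

/-- The form of `hasDerivAt_angular_form` vanishes at both poles, because the angular factors are
bounded and `sin θ` tends to zero, while its derivative is `Im η` times a nonnegative density that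
is positive somewhere. -/
lemma separationConstant_im_eq_zero (hre : M.IsExtreme re)
    (hform : ∀ x ∈ exterior re, Ψ x = M.separated ω k Xp Xm Yp Ym x)
    (haxis : LocallyBoundedAtAxis re Ψ) (hnontrivial : ∃ x ∈ exterior re, Ψ x ≠ 0) {η : ℂ}
    (h : M.AngularEq lam ω k η Yp Ym) : η.im = 0 := by
  obtain ⟨h0, h1, h2, h3⟩ := components_eq hform
  obtain ⟨⟨r₀, hr₀, hX⟩, θ₀, hθ₀, hθ₀', hY⟩ := exists_factor_ne_zero hform hnontrivial
  have o1 : (1 : ℝ) ^ 2 = 1 := one_pow 2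
  have o2 : (-1 : ℝ) ^ 2 = 1 := by norm_num
  obtain ⟨⟨Cp, hCp⟩, Cm, hCm⟩ : (∃ C, ∀ θ, 0 < θ → θ < Real.pi → ‖Yp θ‖ ≤ C) ∧
      ∃ C, ∀ θ, 0 < θ → θ < Real.pi → ‖Ym θ‖ ≤ C := by
    rcases hX with hX | hX
    · exact ⟨bounded_angular_factor hre o1 h1 haxis hr₀ hX,
        bounded_angular_factor hre o2 h2 haxis hr₀ hX⟩
    · exact ⟨bounded_angular_factor hre o2 h3 haxis hr₀ hX,
        bounded_angular_factor hre o1 h0 haxis hr₀ hX⟩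
  set f : ℝ → ℝ := fun y =>
    Real.sin y * √(M.deltaTheta y) * (Yp y * (starRingEnd ℂ) (Ym y)).im with hf
  have hfd {θ : ℝ} (hθ : θ ∈ Set.Ioo 0 Real.pi) := hasDerivAt_angular_form h hθ.1 hθ.2
  have hf0 : f 0 = 0 := by simp [hf]
  have hfπ : f Real.pi = 0 := by simp [hf]
  have hbound : ∀ θ ∈ Set.Icc 0 Real.pi, ‖f θ‖ ≤ Real.sin θ * (Cp * Cm) := by
    intro θ hθ
    rcases hθ.1.eq_or_lt with h' | h'
    · simp [← h', hf0]
    rcases hθ.2.eq_or_lt with h'' | h''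
    · simp [h'', hfπ]
    have hs := Real.sin_nonneg_of_mem_Icc hθ
    have ht : √(M.deltaTheta θ) ≤ 1 := by
      rw [Real.sqrt_le_one, deltaTheta, sub_le_self_iff]
      positivity
    have hi : |(Yp θ * (starRingEnd ℂ) (Ym θ)).im| ≤ Cp * Cm := by
      refine (Complex.abs_im_le_norm _).trans ?_
      rw [norm_mul, RCLike.norm_conj]
      exact mul_le_mul (hCp θ h' h'') (hCm θ h' h'') (norm_nonneg _)
        ((norm_nonneg _).trans (hCp θ h' h''))
    rw [hf, Real.norm_eq_abs, abs_mul, abs_mul, abs_of_nonneg hs,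
      abs_of_nonneg (Real.sqrt_nonneg _)]
    calc _ ≤ Real.sin θ * 1 * (Cp * Cm) := by gcongr
      _ = _ := by ring
  have hend : ∀ θ₁ ∈ Set.Icc 0 Real.pi, Real.sin θ₁ = 0 →
      ContinuousWithinAt f (Set.Icc 0 Real.pi) θ₁ := by
    intro θ₁ hθ₁ hs
    have hz : f θ₁ = 0 := by simp [hf, hs]
    rw [ContinuousWithinAt, hz]
    refine squeeze_zero_norm' (eventually_nhdsWithin_of_forall hbound) ?_
    have : Filter.Tendsto (fun θ => Real.sin θ * (Cp * Cm)) (nhds θ₁)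
        (nhds (Real.sin θ₁ * (Cp * Cm))) :=
      (Real.continuous_sin.mul continuous_const).tendsto θ₁
    rw [hs, zero_mul] at this
    exact this.mono_left nhdsWithin_le_nhds
  have hcont : ContinuousOn f (Set.Icc 0 Real.pi) := by
    intro θ hθ
    rcases hθ.1.eq_or_lt with h' | h'
    · exact hend θ hθ (by simp [← h'])
    rcases hθ.2.eq_or_lt with h'' | h''
    · exact hend θ hθ (by simp [h''])
    exact (hfd ⟨h', h''⟩).continuousAt.continuousWithinAt
  -- The extra factor `Im η` makes the derivative a square times a nonnegative density, so no sign
  -- distinction and no integration are needed. A monotone function vanishing at both ends is zero.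
  have hmono : MonotoneOn (fun θ => η.im * f θ) (Set.Icc 0 Real.pi) := by
    refine monotoneOn_of_deriv_nonneg (convex_Icc _ _) (hcont.const_smul η.im) ?_ ?_
    · rw [interior_Icc]
      exact fun θ hθ => ((hfd hθ).const_mul η.im).differentiableAt.differentiableWithinAt
    · rw [interior_Icc]
      intro θ hθ
      rw [((hfd hθ).const_mul η.im).deriv]
      have := Real.sin_pos_of_mem_Ioo hθ
      have : 0 ≤ Real.sin θ * ((η.im * η.im) * (‖Yp θ‖ ^ 2 + ‖Ym θ‖ ^ 2)) :=
        mul_nonneg this.le (mul_nonneg (mul_self_nonneg _) (by positivity))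
      linarith
  have hconst : ∀ θ ∈ Set.Icc 0 Real.pi, η.im * f θ = 0 := by
    intro θ hθ
    have a1 := hmono (Set.left_mem_Icc.2 Real.pi_pos.le) hθ hθ.1
    have a2 := hmono hθ (Set.right_mem_Icc.2 Real.pi_pos.le) hθ.2
    simp only [hf0, hfπ, mul_zero] at a1 a2
    exact le_antisymm a2 a1
  have hd := (hfd ⟨hθ₀, hθ₀'⟩).const_mul η.im
  have hev : (fun θ => η.im * f θ) =ᶠ[nhds θ₀] fun _ => 0 := by
    filter_upwards [Icc_mem_nhds hθ₀ hθ₀'] with θ hθ using hconst θ hθ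
  have hzero := hd.unique ((hasDerivAt_const θ₀ (0 : ℝ)).congr_of_eventuallyEq hev)
  have hsin := Real.sin_pos_of_pos_of_lt_pi hθ₀ hθ₀'
  have hN : 0 < ‖Yp θ₀‖ ^ 2 + ‖Ym θ₀‖ ^ 2 := by
    rcases hY with hY | hY
    · have := norm_pos_iff.2 hY
      positivity
    · have := norm_pos_iff.2 hY
      positivity
  have := mul_pos hsin hN
  by_contra hne
  have h3 : η.im * η.im * (Real.sin θ₀ * (‖Yp θ₀‖ ^ 2 + ‖Ym θ₀‖ ^ 2)) = 0 := by linarith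
  rcases mul_eq_zero.1 h3 with h4 | h4
  · exact hne (mul_self_eq_zero.1 h4)
  · exact this.ne' h4

end Angular

end

end KNAdS

/-- A Grönwall inequality towards the left end of an interval. -/
lemma mul_exp_le_of_deriv_le {N : ℝ → ℝ} {a b C : ℝ} (hab : a ≤ b)
    (h : ∀ s ∈ Set.Icc a b, ∃ N', HasDerivAt N N' s ∧ N' ≤ C * N s) :
    N b * Real.exp (-C * (b - a)) ≤ N a := by
  choose! N' hN hle using h
  have hd : ∀ s ∈ Set.Icc a b, HasDerivAt (fun y => N y * Real.exp (-C * (y - a)))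
      ((N' s - C * N s) * Real.exp (-C * (s - a))) s := by
    intro s hs
    have h1 : HasDerivAt (fun y => Real.exp (-C * (y - a))) (Real.exp (-C * (s - a)) * (-C)) s := by
      simpa using (((hasDerivAt_id s).sub_const a).const_mul (-C)).exp
    refine ((hN s hs).mul h1).congr_deriv ?_
    ring
  have hanti : AntitoneOn (fun y => N y * Real.exp (-C * (y - a))) (Set.Icc a b) := by
    refine antitoneOn_of_deriv_nonpos (convex_Icc a b)
      (fun s hs => (hd s hs).continuousAt.continuousWithinAt)
      (fun s hs => (hd s (interior_subset hs)).differentiableAt.differentiableWithinAt) ?_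
    intro s hs
    rw [(hd s (interior_subset hs)).deriv]
    exact mul_nonpos_of_nonpos_of_nonneg (sub_nonpos.2 (hle s (interior_subset hs)))
      (Real.exp_nonneg _)
  simpa using hanti (Set.left_mem_Icc.2 hab) (Set.right_mem_Icc.2 hab) hab

namespace KNAdS

noncomputable section

variable {M : KNAdS}

/-! ### The radial equation near the horizon -/

section Radial

variable {re lam ω : ℝ} {k : ℤ} {η : ℝ} {Xp Xm : ℝ → ℂ}

/-- The diagonal terms are imaginary and drop out. As `η` is real, the two off-diagonal coefficients
are conjugate, so their contributions add up. -/
lemma hasDerivAt_radial_norm_sq (hre : M.IsExtreme re)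
    (h : M.RadialEq re lam ω k η Xp Xm) {r : ℝ} (hr : re < r) :
    HasDerivAt (fun s => ‖Xp s‖ ^ 2 + ‖Xm s‖ ^ 2)
      (4 * ((Complex.I * lam * r + η) * (Xm r * (starRingEnd ℂ) (Xp r))).re / √(M.deltaR r)) r := by
  obtain ⟨dp, dm, h1, h2⟩ := h r hr
  have hd := (Real.sqrt_pos.2 (hre.deltaR_pos hr)).ne'
  have hd2 := Real.sq_sqrt (hre.deltaR_pos hr).le
  refine (dp.hasDerivAt.norm_sq.add dm.hasDerivAt.norm_sq).congr_deriv ?_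
  have e1 : deriv Xp r = Complex.I * ((M.radialK ω k r / M.deltaR r : ℝ) : ℂ) * Xp r +
      (Complex.I * lam * r + η) * ((1 / √(M.deltaR r) : ℝ) : ℂ) * Xm r := by
    push_cast
    linear_combination h1
  have e2 : deriv Xm r = -(Complex.I * ((M.radialK ω k r / M.deltaR r : ℝ) : ℂ) * Xm r) -
      (Complex.I * lam * r - η) * ((1 / √(M.deltaR r) : ℝ) : ℂ) * Xp r := by
    push_cast
    linear_combination h2
  rw [e1, e2, Complex.inner, Complex.inner]
  simp
  ring

/-- The phase-corrected quadratic form of a radial solution. -/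
lemma hasDerivAt_radial_form (hre : M.IsExtreme re)
    (h : M.RadialEq re lam ω k η Xp Xm) {r : ℝ} (hr : re < r) {g : ℝ → ℂ} {g' : ℂ}
    (hg : HasDerivAt g g' r)
    (hgK : g r * M.radialK ω k r = (Complex.I * lam * r + η) * √(M.deltaR r)) :
    HasDerivAt (fun s => ‖Xp s‖ ^ 2 + ‖Xm s‖ ^ 2 +
      2 * (g s * (Xm s * (starRingEnd ℂ) (Xp s))).im)
      (2 * (g' * (Xm r * (starRingEnd ℂ) (Xp r))).im) r := by
  obtain ⟨dp, dm, h1, h2⟩ := h r hr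
  have hd := (Real.sqrt_pos.2 (hre.deltaR_pos hr)).ne'
  have hd2 := Real.sq_sqrt (hre.deltaR_pos hr).le
  have hN := hasDerivAt_radial_norm_sq hre h hr
  have hP := hg.mul (dm.hasDerivAt.mul dp.hasDerivAt.star)
  have hI : HasDerivAt (fun s => (g s * (Xm s * (starRingEnd ℂ) (Xp s))).im)
    (g' * (Xm r * (starRingEnd ℂ) (Xp r)) + g r * (deriv Xm r * (starRingEnd ℂ) (Xp r) +
      Xm r * (starRingEnd ℂ) (deriv Xp r))).im r :=
    Complex.imCLM.hasFDerivAt.comp_hasDerivAt r hP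
  refine (hN.add (hI.const_mul 2)).congr_deriv ?_
  have e1 : deriv Xp r = Complex.I * ((M.radialK ω k r / √(M.deltaR r) ^ 2 : ℝ) : ℂ) * Xp r +
      (Complex.I * lam * r + η) * ((1 / √(M.deltaR r) : ℝ) : ℂ) * Xm r := by
    rw [hd2]
    push_cast
    linear_combination h1
  have e2 : deriv Xm r = -(Complex.I * ((M.radialK ω k r / √(M.deltaR r) ^ 2 : ℝ) : ℂ) * Xm r) -
      (Complex.I * lam * r - η) * ((1 / √(M.deltaR r) : ℝ) : ℂ) * Xp r := by
    rw [hd2]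
    push_cast
    linear_combination h2
  -- `g` is a real multiple of `iλr + η`: this is clear when `K ≠ 0`, and when `K = 0` the relation
  -- `hgK` forces `iλr + η = 0`.
  have hreal : (g r).im * η = (g r).re * (lam * r) := by
    have k1 := congrArg Complex.re hgK
    have k2 := congrArg Complex.im hgK
    simp at k1 k2
    by_cases hK : M.radialK ω k r = 0
    · simp [hK, hd] at k1 k2
      rw [k1]
      rcases k2 with k2 | k2 <;> simp [k2]
    · have : M.radialK ω k r * ((g r).im * η - (g r).re * (lam * r)) = 0 := by
        linear_combination η * k2 - lam * r * k1
      rcases mul_eq_zero.1 this with h' | h'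
      · exact absurd h' hK
      · linarith
  have k1 := congrArg Complex.re hgK
  have k2 := congrArg Complex.im hgK
  simp at k1 k2
  have k1' : (g r).re * (M.radialK ω k r / √(M.deltaR r) ^ 2) = η * (1 / √(M.deltaR r)) := by
    field_simp
    linear_combination k1
  have k2' : (g r).im * (M.radialK ω k r / √(M.deltaR r) ^ 2) =
      lam * r * (1 / √(M.deltaR r)) := by
    field_simp
    linear_combination k2
  rw [e1, e2, div_eq_mul_one_div]
  generalize M.radialK ω k r / √(M.deltaR r) ^ 2 = L at *
  generalize 1 / √(M.deltaR r) = s at *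
  simp
  -- `k1'` and `k2'` cancel the growth of `|X|²` against the phase rotation of the cross term;
  -- `hreal` removes the off-diagonal contributions to the derivative of the cross term.
  linear_combination (-4 * ((Xm r).re * (Xp r).re + (Xm r).im * (Xp r).im)) * k1' +
    (4 * ((Xm r).im * (Xp r).re - (Xm r).re * (Xp r).im)) * k2' +
    (2 * s * ((Xm r).re ^ 2 + (Xm r).im ^ 2 + (Xp r).re ^ 2 + (Xp r).im ^ 2)) * hreal

/-- On a compact interval away from the horizon the coefficients are bounded, so Grönwall prevents a
solution that is nonzero at `r₀` from vanishing further left. -/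
lemma radial_norm_sq_pos (hre : M.IsExtreme re) (h : M.RadialEq re lam ω k η Xp Xm) {r₀ : ℝ}
    (hX : Xp r₀ ≠ 0 ∨ Xm r₀ ≠ 0) {r : ℝ} (hr : re < r) (hrr : r ≤ r₀) :
    0 < ‖Xp r‖ ^ 2 + ‖Xm r‖ ^ 2 := by
  have hN : 0 < ‖Xp r₀‖ ^ 2 + ‖Xm r₀‖ ^ 2 := by
    rcases hX with hX | hX
    · have := norm_pos_iff.2 hX
      positivity
    · have := norm_pos_iff.2 hX
      positivity
  have hcont : ContinuousOn (fun s : ℝ => 2 * ‖Complex.I * lam * s + η‖ / √(M.deltaR s))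
      (Set.Icc r r₀) := by
    refine ContinuousOn.div (by fun_prop)
      (M.differentiable_deltaR.continuous.sqrt.continuousOn) ?_
    exact fun s hs => (Real.sqrt_pos.2 (hre.deltaR_pos (hr.trans_le hs.1))).ne'
  obtain ⟨C, hC⟩ := isCompact_Icc.exists_bound_of_continuousOn hcont
  refine lt_of_lt_of_le (mul_pos hN (Real.exp_pos (-C * (r₀ - r)))) ?_
  refine mul_exp_le_of_deriv_le (N := fun s => ‖Xp s‖ ^ 2 + ‖Xm s‖ ^ 2) hrr fun s hs =>
    ⟨_, hasDerivAt_radial_norm_sq hre h (hr.trans_le hs.1), ?_⟩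
  have hd := Real.sqrt_pos.2 (hre.deltaR_pos (hr.trans_le hs.1))
  have h1 := (Real.le_norm_self _).trans (hC s hs)
  have h2 : ((Complex.I * lam * s + η) * (Xm s * (starRingEnd ℂ) (Xp s))).re ≤
      ‖Complex.I * lam * s + η‖ * (‖Xm s‖ * ‖Xp s‖) := by
    refine (Complex.re_le_norm _).trans ?_
    rw [norm_mul, norm_mul, RCLike.norm_conj]
  calc 4 * ((Complex.I * lam * s + η) * (Xm s * (starRingEnd ℂ) (Xp s))).re / √(M.deltaR s)
      ≤ 4 * (‖Complex.I * lam * s + η‖ * (‖Xm s‖ * ‖Xp s‖)) / √(M.deltaR s) := by gcongr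
    _ = 2 * ‖Complex.I * lam * s + η‖ / √(M.deltaR s) * (2 * (‖Xm s‖ * ‖Xp s‖)) := by ring
    _ ≤ 2 * ‖Complex.I * lam * s + η‖ / √(M.deltaR s) * (‖Xp s‖ ^ 2 + ‖Xm s‖ ^ 2) := by
        gcongr
        nlinarith [sq_nonneg (‖Xm s‖ - ‖Xp s‖)]
    _ ≤ C * (‖Xp s‖ ^ 2 + ‖Xm s‖ ^ 2) := by gcongr

/-- A radial solution stays bounded away from zero at the horizon if the coefficient ratio `g`
extends to the horizon with modulus less than one. -/
lemma radial_lower_bound (hre : M.IsExtreme re) (h : M.RadialEq re lam ω k η Xp Xm) {r₀ : ℝ}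
    (hr₀ : re < r₀) (hX : Xp r₀ ≠ 0 ∨ Xm r₀ ≠ 0) {g : ℝ → ℂ} (hg : ContDiffAt ℝ 1 g re)
    (hg1 : ‖g re‖ < 1) (hgK : ∀ᶠ r in nhdsWithin re (Set.Ioi re),
      g r * M.radialK ω k r = (Complex.I * lam * r + η) * √(M.deltaR r)) :
    ∃ c, 0 < c ∧ ∀ᶠ r in nhdsWithin re (Set.Ioi re), c ≤ ‖Xp r‖ ^ 2 + ‖Xm r‖ ^ 2 := by
  -- The margin `1 - q` makes the form `G` below coercive near the horizon, and the Lipschitz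
  -- constant `L` bounds `g'` uniformly up to it.
  obtain ⟨q, hgq, hq1⟩ := exists_between hg1
  have hq0 : 0 < q := (norm_nonneg _).trans_lt hgq
  obtain ⟨L, t, ht, hL⟩ := hg.exists_lipschitzOnWith
  have hnear : ∀ᶠ r in nhds re, ‖g r‖ < q ∧ DifferentiableAt ℝ g r ∧ ‖deriv g r‖ ≤ L := by
    have e1 := hg.continuousAt.norm.eventually (gt_mem_nhds hgq)
    have e2 : ∀ᶠ r in nhds re, ContDiffAt ℝ 1 g r := hg.eventually (by simp)
    filter_upwards [e1, e2, eventually_mem_nhds_iff.2 ht] with r a1 a2 a3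
    exact ⟨a1, a2.differentiableAt one_ne_zero, norm_deriv_le_of_lipschitzOn a3 hL⟩
  have hall := (hnear.filter_mono nhdsWithin_le_nhds).and hgK
  obtain ⟨b, hb, hb'⟩ := mem_nhdsGT_iff_exists_Ioc_subset.1 hall
  rw [Set.mem_Ioi] at hb
  set r₁ := min b r₀ with hr₁
  have hr₁re : re < r₁ := lt_min hb hr₀
  have hN1 := radial_norm_sq_pos hre h hX hr₁re (min_le_right _ _)
  set G : ℝ → ℝ := fun s => ‖Xp s‖ ^ 2 + ‖Xm s‖ ^ 2 +
      2 * (g s * (Xm s * (starRingEnd ℂ) (Xp s))).im with hG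
  have hprod (z : ℂ) (s : ℝ) : |2 * (z * (Xm s * (starRingEnd ℂ) (Xp s))).im| ≤
      ‖z‖ * (‖Xp s‖ ^ 2 + ‖Xm s‖ ^ 2) := by
    rw [abs_mul, abs_two]
    have h1 := Complex.abs_im_le_norm (z * (Xm s * (starRingEnd ℂ) (Xp s)))
    rw [norm_mul, norm_mul, RCLike.norm_conj] at h1
    have h2 := mul_nonneg (norm_nonneg z) (sq_nonneg (‖Xm s‖ - ‖Xp s‖))
    linarith
  have hGlow : ∀ s ∈ Set.Ioc re r₁, (1 - q) * (‖Xp s‖ ^ 2 + ‖Xm s‖ ^ 2) ≤ G s := by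
    intro s hs
    obtain ⟨⟨a1, -, -⟩, -⟩ := hb' ⟨hs.1, hs.2.trans (min_le_left _ _)⟩
    have h1 := neg_le_of_abs_le (hprod (g s) s)
    have h2 : ‖g s‖ * (‖Xp s‖ ^ 2 + ‖Xm s‖ ^ 2) ≤ q * (‖Xp s‖ ^ 2 + ‖Xm s‖ ^ 2) := by
      gcongr
    simp only [hG]
    linarith
  have hGup : ∀ s ∈ Set.Ioc re r₁, G s ≤ 2 * (‖Xp s‖ ^ 2 + ‖Xm s‖ ^ 2) := by
    intro s hs
    obtain ⟨⟨a1, -, -⟩, -⟩ := hb' ⟨hs.1, hs.2.trans (min_le_left _ _)⟩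
    have h1 := le_of_abs_le (hprod (g s) s)
    have h2 : ‖g s‖ * (‖Xp s‖ ^ 2 + ‖Xm s‖ ^ 2) ≤ 1 * (‖Xp s‖ ^ 2 + ‖Xm s‖ ^ 2) := by
      gcongr
      exact (a1.trans hq1).le
    simp only [hG]
    linarith
  have hq : 0 < 1 - q := sub_pos.2 hq1
  have hG1 : 0 < G r₁ :=
    (mul_pos hq hN1).trans_le (hGlow r₁ ⟨hr₁re, le_rfl⟩)
  -- From `G' ≤ L |X|²` and `(1 - q) |X|² ≤ G` comes `G' ≤ C G`, with `C` independent of how close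
  -- to the horizon the interval reaches.
  set C : ℝ := L / (1 - q) with hC
  refine ⟨G r₁ * Real.exp (-C * (r₁ - re)) / 2, by positivity, ?_⟩
  filter_upwards [Ioc_mem_nhdsGT hr₁re] with r hr
  have hgron : G r₁ * Real.exp (-C * (r₁ - r)) ≤ G r := by
    refine mul_exp_le_of_deriv_le hr.2 fun s hs => ?_
    have hs' : s ∈ Set.Ioc re r₁ := ⟨hr.1.trans_le hs.1, hs.2⟩
    obtain ⟨⟨a1, a2, a3⟩, a4⟩ := hb' ⟨hs'.1, hs'.2.trans (min_le_left _ _)⟩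
    refine ⟨_, hasDerivAt_radial_form hre h hs'.1 a2.hasDerivAt a4, ?_⟩
    have h1 := le_of_abs_le (hprod (deriv g s) s)
    have h2 : ‖deriv g s‖ * (‖Xp s‖ ^ 2 + ‖Xm s‖ ^ 2) ≤ L * (‖Xp s‖ ^ 2 + ‖Xm s‖ ^ 2) := by
      gcongr
    have h3 : L * (‖Xp s‖ ^ 2 + ‖Xm s‖ ^ 2) = C * ((1 - q) * (‖Xp s‖ ^ 2 + ‖Xm s‖ ^ 2)) := by
      rw [hC]
      field_simp
    have h4 : C * ((1 - q) * (‖Xp s‖ ^ 2 + ‖Xm s‖ ^ 2)) ≤ C * G s := by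
      have := hGlow s hs'
      gcongr
    linarith
  have hexp : Real.exp (-C * (r₁ - re)) ≤ Real.exp (-C * (r₁ - r)) := by
    have hC0 : 0 ≤ C := by positivity
    refine Real.exp_le_exp.2 ?_
    nlinarith [hr.1]
  have h5 := mul_le_mul_of_nonneg_left hexp hG1.le
  have h6 := hGup r hr
  linarith

end Radial

end

end KNAdS

/-- The function `c / (r - a)` is not integrable at `a`, also on a box. -/
lemma lintegral_div_sub_box {a ε c : ℝ} (hε : 0 < ε) (hc : 0 < c) {S : Set (ℝ × ℝ)}
    (hS : volume S ≠ 0) :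
    ∫⁻ q in Set.Ioo a (a + ε) ×ˢ S, ENNReal.ofReal (c / (q.1 - a)) ∂(volume : Measure (ℝ × ℝ × ℝ)) =
      ∞ := by
  have h1 : ∫⁻ r in Set.Ioo a (a + ε), ENNReal.ofReal (c / (r - a)) = ∞ := by
    by_contra hfin
    have hmeas : AEStronglyMeasurable (fun r : ℝ => c / (r - a))
        (volume.restrict (Set.Ioo a (a + ε))) :=
      (measurable_const.div (measurable_id.sub_const a)).aestronglyMeasurable
    have hint : IntegrableOn (fun r : ℝ => c / (r - a)) (Set.Ioo a (a + ε)) := by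
      refine (lintegral_ofReal_ne_top_iff_integrable hmeas ?_).1 hfin
      filter_upwards [ae_restrict_mem measurableSet_Ioo] with r hr
      exact div_nonneg hc.le (sub_pos.2 hr.1).le
    have h2 : IntervalIntegrable (fun r : ℝ => (r - a)⁻¹) volume a (a + ε) := by
      rw [intervalIntegrable_iff_integrableOn_Ioo_of_le (by linarith)]
      refine (hint.const_mul c⁻¹).congr (Filter.Eventually.of_forall fun r => ?_)
      simp only
      field_simp
    rw [intervalIntegrable_sub_inv_iff] at h2
    rcases h2 with h2 | h2
    · linarith
    · exact h2 (Set.mem_uIcc.2 (Or.inl ⟨le_rfl, by linarith⟩))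
  rw [Measure.volume_eq_prod, ← Measure.prod_restrict,
    lintegral_prod _ (by fun_prop)]
  simp only [lintegral_const, Measure.restrict_apply_univ]
  rw [lintegral_mul_const _ (by fun_prop), h1, ENNReal.top_mul hS]

namespace KNAdS

noncomputable section

variable {M : KNAdS}

/-! ### The volume of the slice near the horizon -/

/-- `(r - re)²` times the determinant of the metric induced on a time slice. -/
def regularDet (M : KNAdS) (re r θ : ℝ) : ℝ :=
  M.U r θ * Real.sin θ ^ 2 * (M.deltaTheta θ * (r ^ 2 + M.a ^ 2) ^ 2 -
    (r - re) ^ 2 * M.quadB re r * M.a ^ 2 * Real.sin θ ^ 2) /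
      (M.E ^ 2 * M.quadB re r * M.deltaTheta θ)

/-- The double zero of `Δ₋` in the denominator of `g_rr` is the only singularity of the determinant,
so its square root contributes `1/(r - re)`. -/
lemma sliceDensity_eq {re : ℝ} (hre : M.IsExtreme re) {r : ℝ} (hr : re < r) (t θ φ : ℝ) :
    M.sliceDensity t (r, θ, φ) = √(M.regularDet re r θ) / (r - re) := by
  have hx : 0 < r - re := sub_pos.2 hr
  have hB := quadB_pos (M := M) hre.1 (hre.1.trans hr).le
  have hU := M.U_pos (hre.1.trans hr) θ
  have ht := M.deltaTheta_pos θ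
  have hE := M.E_ne_zero
  rw [← Real.sqrt_sq hx.le, ← Real.sqrt_div' _ (sq_nonneg _), sliceDensity]
  congr 1
  rw [Matrix.det_fin_three]
  simp [metric, formT, formPhi, slicePoint, hre.deltaR_factor, regularDet, Pi.single_apply]
  field_simp
  ring

/-- At `r = re` the negative term of `regularDet` vanishes, leaving a positive value off the axis;
continuity extends half of it to a neighbourhood. -/
lemma exists_sliceDensity_lower_bound {re : ℝ} (hre : M.IsExtreme re) {θ₀ : ℝ} (h0 : 0 < θ₀)
    (hπ : θ₀ < Real.pi) : ∃ c, 0 < c ∧ ∀ᶠ q : ℝ × ℝ in nhds (re, θ₀), re < q.1 →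
      ∀ t φ, c / (q.1 - re) ≤ M.sliceDensity t (q.1, q.2, φ) := by
  have hB := quadB_pos (M := M) hre.1 hre.1.le
  have ht := M.deltaTheta_pos θ₀
  have hU := M.U_pos hre.1 θ₀
  have hs := Real.sin_pos_of_pos_of_lt_pi h0 hπ
  have hE := M.E_ne_zero
  have hr := hre.1
  have hpos : 0 < M.regularDet re re θ₀ := by
    simp only [regularDet, sub_self]
    have : 0 < M.E ^ 2 := by positivity
    have h2 : M.deltaTheta θ₀ * (re ^ 2 + M.a ^ 2) ^ 2 - 0 ^ 2 * M.quadB re re * M.a ^ 2 *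
      Real.sin θ₀ ^ 2 = M.deltaTheta θ₀ * (re ^ 2 + M.a ^ 2) ^ 2 := by ring
    rw [h2]
    positivity
  have hcont : ContinuousAt (fun q : ℝ × ℝ => M.regularDet re q.1 q.2) (re, θ₀) := by
    unfold regularDet
    refine ContinuousAt.div ?_ ?_ ?_
    · unfold U deltaTheta quadB
      fun_prop
    · unfold deltaTheta quadB
      fun_prop
    · simp only
      positivity
  refine ⟨√(M.regularDet re re θ₀ / 2), Real.sqrt_pos.2 (by positivity), ?_⟩
  filter_upwards [hcont.eventually (lt_mem_nhds (half_lt_self hpos))] with q hq hq1 t φ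
  rw [sliceDensity_eq hre hq1]
  have : 0 < q.1 - re := sub_pos.2 hq1
  gcongr

/-- For finite `p`, the set where an `L^p` function has norm at least `c` has finite measure. Here
that set contains a box touching the horizon, whose volume diverges logarithmically. -/
lemma not_memLpSlice_of_eventually_le {re : ℝ} (hre : M.IsExtreme re) {Ψ : Coord → Spinor}
    {θ₀ : ℝ} (h0 : 0 < θ₀) (hπ : θ₀ < Real.pi) {c : ℝ} (hc : 0 < c) {t : ℝ}
    (hΨ : ∀ᶠ q : ℝ × ℝ in nhds (re, θ₀), re < q.1 →
      ∀ φ, c ≤ ‖WithLp.toLp 2 (Ψ (slicePoint t (q.1, q.2, φ)))‖)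
    {p : ℝ≥0∞} (hp : 1 ≤ p) (hp' : p ≠ ∞) : ¬ M.MemLpSlice re t p Ψ := by
  intro hLp
  obtain ⟨b, hb, hden⟩ := exists_sliceDensity_lower_bound hre h0 hπ
  have hθ : ∀ᶠ q : ℝ × ℝ in nhds (re, θ₀), q.2 ∈ Set.Ioo 0 Real.pi :=
    continuous_snd.continuousAt.eventually (Ioo_mem_nhds h0 hπ)
  obtain ⟨ε, hε, hball⟩ := Metric.eventually_nhds_iff_ball.1 (hΨ.and (hden.and hθ))
  have hfin := MemLp.meas_ge_lt_top hLp (zero_lt_one.trans_le hp).ne' hp'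
    (ε := ⟨c, hc.le⟩) (fun h => hc.ne' (congrArg NNReal.toReal h))
  set box : Set (ℝ × ℝ × ℝ) := Set.Ioo re (re + ε) ×ˢ
    (Set.Ioo (θ₀ - ε) (θ₀ + ε) ×ˢ Set.Ioo 0 (2 * Real.pi)) with hbox
  have hboxm : MeasurableSet box :=
    measurableSet_Ioo.prod (measurableSet_Ioo.prod measurableSet_Ioo)
  have hmem : ∀ q ∈ box, (q.1, q.2.1) ∈ Metric.ball (re, θ₀) ε := by
    rintro ⟨r, θ, φ⟩ ⟨h1, h2, -⟩
    rw [← ball_prod_same, Real.ball_eq_Ioo, Real.ball_eq_Ioo]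
    exact ⟨⟨by linarith [h1.1], h1.2⟩, h2⟩
  have hsub : box ⊆ {q | (⟨c, hc.le⟩ : NNReal) ≤
      ‖(WithLp.toLp 2 (Ψ (slicePoint t q)) : EuclideanSpace ℂ (Fin 4))‖₊} := by
    intro q hq
    exact (hball _ (hmem q hq)).1 hq.1.1 q.2.2
  refine (lt_of_le_of_lt (measure_mono hsub) hfin).ne ?_
  have hsub2 : box ⊆ Set.Ioi re ×ˢ Set.Ioo 0 Real.pi ×ˢ Set.Ioo 0 (2 * Real.pi) := by
    intro q hq
    exact ⟨hq.1.1, (hball _ (hmem q hq)).2.2, hq.2.2⟩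
  rw [sliceMeasure, withDensity_apply _ hboxm, Measure.restrict_restrict hboxm,
    Set.inter_eq_left.2 hsub2, ← top_le_iff]
  have hvol : volume (Set.Ioo (θ₀ - ε) (θ₀ + ε) ×ˢ Set.Ioo 0 (2 * Real.pi)) ≠ 0 := by
    rw [Measure.volume_eq_prod, Measure.prod_prod, Real.volume_Ioo, Real.volume_Ioo]
    refine mul_ne_zero ?_ ?_
    · simp only [ne_eq, ENNReal.ofReal_eq_zero, not_le]
      linarith
    · simp [Real.pi_pos]
  calc ∞ = ∫⁻ q in box, ENNReal.ofReal (b / (q.1 - re)) := (lintegral_div_sub_box hε hb hvol).symm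
    _ ≤ _ := by
      refine setLIntegral_mono' hboxm fun q hq => ENNReal.ofReal_le_ofReal ?_
      exact (hball _ (hmem q hq)).2.1 hq.1.1 t q.2.2

/-! ### Integrable separated solutions -/

section Main

variable {re lam ω : ℝ} {k : ℤ} {Xp Xm Yp Ym : ℝ → ℂ} {Ψ : Coord → Spinor}

/-- The phase has modulus one and the weight is bounded above near the horizon, so dividing by it
costs at most a constant. -/
lemma norm_sepComponent_ge (hre : M.IsExtreme re) {ε : ℝ} (hε : ε ^ 2 = 1) {X Y : ℝ → ℂ} {r : ℝ}
    (hr : re < r) (hr1 : r ≤ re + 1) (hΔ : M.deltaR r ≤ 1) (t θ φ : ℝ) :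
    ‖X r‖ * ‖Y θ‖ / (1 + (re + 1 + |M.a|)) ≤
      ‖M.sepComponent ω k ε X Y (slicePoint t (r, θ, φ))‖ := by
  have hΔ0 := hre.deltaR_pos hr
  have hr0 := hre.1.trans hr
  have hexp (y : ℝ) : ‖Complex.exp (-Complex.I * y)‖ = 1 := by
    rw [Complex.norm_exp]
    simp
  have hd : ‖((M.deltaR r ^ (1 / 4 : ℝ) : ℝ) : ℂ)‖ ≤ 1 := by
    rw [Complex.norm_real, Real.norm_of_nonneg (Real.rpow_nonneg hΔ0.le _)]
    exact Real.rpow_le_one hΔ0.le hΔ (by norm_num)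
  have hd0 := norm_pos_iff.2 (quarter_ne_zero hΔ0)
  have hz0 := norm_pos_iff.2 (M.rootFactor_ne_zero ε θ hr0)
  have hz : ‖M.rootFactor ε r θ‖ ≤ 1 + (re + 1 + |M.a|) := by
    have h1 := norm_rootFactor_sq_le (M := M) ε hε r θ
    rw [abs_of_pos hr0] at h1
    nlinarith [sq_nonneg (‖M.rootFactor ε r θ‖ - 1)]
  have hdz : ‖((M.deltaR r ^ (1 / 4 : ℝ) : ℝ) : ℂ)‖ * ‖M.rootFactor ε r θ‖ ≤
      1 + (re + 1 + |M.a|) :=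
    (mul_le_of_le_one_left hz0.le hd).trans hz
  have hval : ‖M.sepComponent ω k ε X Y (slicePoint t (r, θ, φ))‖ = ‖X r‖ * ‖Y θ‖ /
      (‖((M.deltaR r ^ (1 / 4 : ℝ) : ℝ) : ℂ)‖ * ‖M.rootFactor ε r θ‖) := by
    rw [sepComponent, norm_mul, hexp, one_mul, norm_mul, norm_inv, norm_mul, norm_mul,
      div_eq_inv_mul (‖X r‖ * ‖Y θ‖)]
    rfl
  rw [hval]
  gcongr

lemma eventually_le_norm (hre : M.IsExtreme re) {i j : Fin 4} {ε₁ ε₂ : ℝ} (hε₁ : ε₁ ^ 2 = 1)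
    (hε₂ : ε₂ ^ 2 = 1) {Y : ℝ → ℂ}
    (hi : ∀ x ∈ exterior re, Ψ x i = M.sepComponent ω k ε₁ Xp Y x)
    (hj : ∀ x ∈ exterior re, Ψ x j = M.sepComponent ω k ε₂ Xm Y x) {c : ℝ} (hc : 0 < c)
    (hX : ∀ᶠ r in nhdsWithin re (Set.Ioi re), c ≤ ‖Xp r‖ ^ 2 + ‖Xm r‖ ^ 2) {θ₀ : ℝ}
    (h0 : 0 < θ₀) (hπ : θ₀ < Real.pi) (hY : ContinuousAt Y θ₀) (hY0 : Y θ₀ ≠ 0) (t : ℝ) :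
    ∃ b, 0 < b ∧ ∀ᶠ q : ℝ × ℝ in nhds (re, θ₀), re < q.1 →
      ∀ φ, b ≤ ‖WithLp.toLp 2 (Ψ (slicePoint t (q.1, q.2, φ)))‖ := by
  have hD : 0 < 1 + (re + 1 + |M.a|) := by
    have := hre.1
    positivity
  have hn := norm_pos_iff.2 hY0
  refine ⟨√(c / 2) * (‖Y θ₀‖ / 2) / (1 + (re + 1 + |M.a|)), by positivity, ?_⟩
  have hfst : ContinuousAt (Prod.fst : ℝ × ℝ → ℝ) (re, θ₀) := continuousAt_fst
  have hsnd : ContinuousAt (Prod.snd : ℝ × ℝ → ℝ) (re, θ₀) := continuousAt_snd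
  have hΔ0 : M.deltaR re < 1 := by
    rw [hre.deltaR_factor]
    simp
  filter_upwards [hfst.eventually (eventually_nhdsWithin_iff.1 hX),
    hfst.eventually (gt_mem_nhds (lt_add_one re)),
    hfst.eventually ((M.differentiable_deltaR re).continuousAt.eventually (gt_mem_nhds hΔ0)),
    hsnd.eventually (Ioo_mem_nhds h0 hπ),
    hsnd.eventually (hY.norm.eventually (lt_mem_nhds (half_lt_self hn)))] with
    q q1 q2 q3 q4 q5 hq φ
  have hx : slicePoint t (q.1, q.2, φ) ∈ exterior re := ⟨hq, q4.1, q4.2⟩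
  -- Which radial factor is large may change with `r`; the components `i` and `j` share the same
  -- `Y`, so either one serves.
  have hsq : c / 2 ≤ ‖Xp q.1‖ ^ 2 ∨ c / 2 ≤ ‖Xm q.1‖ ^ 2 := by
    by_contra! hcon
    linarith [q1 hq]
  have hcomp (l : Fin 4) : ‖Ψ (slicePoint t (q.1, q.2, φ)) l‖ ≤
      ‖WithLp.toLp 2 (Ψ (slicePoint t (q.1, q.2, φ)))‖ :=
    PiLp.norm_apply_le (WithLp.toLp 2 (Ψ (slicePoint t (q.1, q.2, φ)))) l
  rcases hsq with hsq | hsq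
  · refine le_trans ?_ (hcomp i)
    rw [hi _ hx]
    refine le_trans ?_ (norm_sepComponent_ge hre hε₁ hq q2.le q3.le t q.2 φ)
    have := Real.sqrt_le_iff.2 ⟨norm_nonneg _, hsq⟩
    gcongr
  · refine le_trans ?_ (hcomp j)
    rw [hj _ hx]
    refine le_trans ?_ (norm_sepComponent_ge hre hε₂ hq q2.le q3.le t q.2 φ)
    have := Real.sqrt_le_iff.2 ⟨norm_nonneg _, hsq⟩
    gcongr

/-- Integrable separated solutions of the Dirac equation do not stay bounded away from zero at the
horizon. -/
lemma not_eventually_le_radial (hre : M.IsExtreme re)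
    (hform : ∀ x ∈ exterior re, Ψ x = M.separated ω k Xp Xm Yp Ym x)
    (hsol : M.IsDiracSolution re lam Ψ) (hnontrivial : ∃ x ∈ exterior re, Ψ x ≠ 0)
    {t : ℝ} {p : ℝ≥0∞} (hp : 1 ≤ p) (hp' : p ≠ ∞) (hLp : M.MemLpSlice re t p Ψ) {c : ℝ}
    (hc : 0 < c) :
    ¬ ∀ᶠ r in nhdsWithin re (Set.Ioi re), c ≤ ‖Xp r‖ ^ 2 + ‖Xm r‖ ^ 2 := by
  intro hX
  obtain ⟨h0, h1, h2, h3⟩ := components_eq hform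
  obtain ⟨-, θ₀, hθ₀, hθ₀', hY⟩ := exists_factor_ne_zero hform hnontrivial
  have hdY := (differentiableAt_factors hre hform (fun x hx => (hsol x hx).1) hnontrivial).2 θ₀
    hθ₀ hθ₀'
  have o1 : (1 : ℝ) ^ 2 = 1 := one_pow 2
  have o2 : (-1 : ℝ) ^ 2 = 1 := by norm_num
  rcases hY with hY | hY
  · obtain ⟨b, hb, hev⟩ := eventually_le_norm hre o1 o2 h1 h3 hc hX hθ₀ hθ₀'
      hdY.1.continuousAt hY t
    exact not_memLpSlice_of_eventually_le hre hθ₀ hθ₀' hb hev hp hp' hLp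
  · obtain ⟨b, hb, hev⟩ := eventually_le_norm hre o2 o1 h2 h0 hc hX hθ₀ hθ₀'
      hdY.2.continuousAt hY t
    exact not_memLpSlice_of_eventually_le hre hθ₀ hθ₀' hb hev hp hp' hLp

/-- Here `h` is a `C¹` extension of `(r - re)/K` to the horizon, and `g = (iλr + η) √B₋ h`. The
conclusion is `|g(re)|² ≥ 1`, the negation of the hypothesis of `radial_lower_bound`. -/
lemma one_le_of_memLpSlice (hre : M.IsExtreme re)
    (hform : ∀ x ∈ exterior re, Ψ x = M.separated ω k Xp Xm Yp Ym x)
    (hsol : M.IsDiracSolution re lam Ψ) (hnontrivial : ∃ x ∈ exterior re, Ψ x ≠ 0)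
    {t : ℝ} {p : ℝ≥0∞} (hp : 1 ≤ p) (hp' : p ≠ ∞) (hLp : M.MemLpSlice re t p Ψ) {η : ℝ}
    (hη : M.RadialEq re lam ω k η Xp Xm) {h : ℝ → ℝ} (hh : ContDiffAt ℝ 1 h re)
    (hK : ∀ᶠ r in nhdsWithin re (Set.Ioi re), h r * M.radialK ω k r = r - re) :
    1 ≤ (η ^ 2 + lam ^ 2 * re ^ 2) * M.quadB re re * h re ^ 2 := by
  by_contra! hlt
  obtain ⟨⟨r₀, hr₀, hX⟩, -⟩ := exists_factor_ne_zero hform hnontrivial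
  have hB := quadB_pos (M := M) hre.1 hre.1.le
  have hg : ContDiffAt ℝ 1 (fun r : ℝ => (Complex.I * lam * r + η) *
      ((√(M.quadB re r) * h r : ℝ) : ℂ)) re := by
    have hB' : ContDiffAt ℝ 1 (fun r => √(M.quadB re r)) re := by
      refine ContDiffAt.sqrt ?_ hB.ne'
      unfold quadB
      fun_prop
    have hof : ContDiff ℝ 1 (fun r : ℝ => (r : ℂ)) := Complex.ofRealCLM.contDiff
    refine ContDiffAt.mul ?_ (hof.contDiffAt.comp re (hB'.mul hh))
    exact (contDiffAt_const.mul hof.contDiffAt).add contDiffAt_const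
  have hg1 : ‖(Complex.I * lam * re + η) * ((√(M.quadB re re) * h re : ℝ) : ℂ)‖ < 1 := by
    rw [← sq_lt_one_iff₀ (norm_nonneg _), ← Complex.normSq_eq_norm_sq, Complex.normSq_mul,
      Complex.normSq_ofReal, Complex.normSq_apply]
    simp
    refine lt_of_eq_of_lt ?_ hlt
    linear_combination ((η ^ 2 + lam ^ 2 * re ^ 2) * h re ^ 2) * Real.sq_sqrt hB.le
  obtain ⟨c, hc, hev⟩ := radial_lower_bound hre hη hr₀ hX hg hg1 (by
    filter_upwards [hK, self_mem_nhdsWithin] with r hr hr'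
    have hd : √(M.deltaR r) = (r - re) * √(M.quadB re r) := by
      rw [hre.deltaR_factor, Real.sqrt_mul (sq_nonneg _), Real.sqrt_sq (sub_pos.2 hr').le]
    rw [hd, ← hr]
    push_cast
    ring)
  exact not_eventually_le_radial hre hform hsol hnontrivial hp hp' hLp hc hev

lemma contDiff_radialK (ω : ℝ) (k : ℤ) : ContDiff ℝ 1 (M.radialK ω k) := by
  unfold radialK
  fun_prop

/-- Otherwise `(r - re)/K` is `C¹` near `re` and vanishes there, so `one_le_of_memLpSlice` would
read `1 ≤ 0`. -/
lemma radialK_horizon_eq_zero (hre : M.IsExtreme re)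
    (hform : ∀ x ∈ exterior re, Ψ x = M.separated ω k Xp Xm Yp Ym x)
    (hsol : M.IsDiracSolution re lam Ψ) (hnontrivial : ∃ x ∈ exterior re, Ψ x ≠ 0)
    {t : ℝ} {p : ℝ≥0∞} (hp : 1 ≤ p) (hp' : p ≠ ∞) (hLp : M.MemLpSlice re t p Ψ) {η : ℝ}
    (hη : M.RadialEq re lam ω k η Xp Xm) : M.radialK ω k re = 0 := by
  by_contra hne
  have hK := contDiff_radialK (M := M) ω k
  have h1 := one_le_of_memLpSlice hre hform hsol hnontrivial hp hp' hLp hη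
    (h := fun r => (r - re) / M.radialK ω k r)
    ((contDiffAt_id.sub contDiffAt_const).div hK.contDiffAt hne) (by
      filter_upwards [(hK.continuous.continuousAt.eventually_ne hne).filter_mono
        nhdsWithin_le_nhds] with r hr
      field_simp)
  simp at h1
  linarith

/-- `K` is a polynomial of degree at most two with root `re`. Its constant term fixes the other
factor, so that `ζ₃` is `K'(re)`. -/
lemma radialK_eq_mul (hr : 0 < re) (hK : M.radialK ω k re = 0) (r : ℝ) :
    M.radialK ω k r = (r - re) * (M.zeta3 re ω k + ω * (r - re)) := by
  have hr' := hr.ne'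
  unfold radialK at hK ⊢
  unfold zeta3
  field_simp
  linear_combination (2 * r) * hK

lemma condI_of_memLpSlice (hre : M.IsExtreme re)
    (hform : ∀ x ∈ exterior re, Ψ x = M.separated ω k Xp Xm Yp Ym x)
    (hsol : M.IsDiracSolution re lam Ψ) (hnontrivial : ∃ x ∈ exterior re, Ψ x ≠ 0)
    {t : ℝ} {p : ℝ≥0∞} (hp : 1 ≤ p) (hp' : p ≠ ∞) (hLp : M.MemLpSlice re t p Ψ) {η : ℝ}
    (hη : M.RadialEq re lam ω k η Xp Xm) : M.CondI re lam ω η k := by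
  have hK := radialK_horizon_eq_zero hre hform hsol hnontrivial hp hp' hLp hη
  have hB := quadB_pos (M := M) hre.1 hre.1.le
  rw [CondI, zeta1, hre.B_eval]
  -- If `ζ₃ = 0`, the inequality only says that a nonnegative quantity is nonnegative. Otherwise
  -- `1/(ζ₃ + ω(r - re))` is the required extension of `(r - re)/K`.
  by_cases hz : M.zeta3 re ω k = 0
  · rw [hz]
    have : 0 ≤ (η ^ 2 + lam ^ 2 * re ^ 2) * M.quadB re re := by positivity
    linarith
  have hcd : ContDiff ℝ 1 fun r : ℝ => M.zeta3 re ω k + ω * (r - re) := by fun_prop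
  have hne : M.zeta3 re ω k + ω * (re - re) ≠ 0 := by simpa using hz
  have h1 := one_le_of_memLpSlice hre hform hsol hnontrivial hp hp' hLp hη
    (h := fun r => (M.zeta3 re ω k + ω * (r - re))⁻¹) (hcd.contDiffAt.inv hne) (by
      filter_upwards [(hcd.continuous.continuousAt.eventually_ne hne).filter_mono
        nhdsWithin_le_nhds] with r hr
      rw [radialK_eq_mul hre.1 hK]
      field_simp)
  simp only [sub_self, mul_zero, add_zero] at h1
  have hz2 : 0 < M.zeta3 re ω k ^ 2 := by positivity
  rw [inv_pow, ← div_eq_mul_inv, one_le_div hz2] at h1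
  linarith

end Main

end

end KNAdS

theorem mainTheorem5 (M : KNAdS) (re : ℝ) (hre : M.IsExtreme re)
    (lam ω : ℝ) (k : ℤ) (Xp Xm Yp Ym : ℝ → ℂ) (Ψ : KNAdS.Coord → KNAdS.Spinor)
    (hform : ∀ x ∈ KNAdS.exterior re, Ψ x = M.separated ω k Xp Xm Yp Ym x)
    (hsol : M.IsDiracSolution re lam Ψ)
    (haxis : KNAdS.LocallyBoundedAtAxis re Ψ)
    (hnontrivial : ∃ x ∈ KNAdS.exterior re, Ψ x ≠ 0)
    (t : ℝ) (p : ℝ≥0∞) (hp : 1 ≤ p) (hp' : p ≠ ∞)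
    (hLp : M.MemLpSlice re t p Ψ) :
    ∃ η : ℝ,
      (∀ η' : ℂ, M.IsSeparationConstant re lam ω k Xp Xm Yp Ym η' ↔ η' = (η : ℂ)) ∧
      (M.CondI re lam ω η k ∨ M.CondII re ω k ∨ M.CondIII re ω k) ∧
      (η = 0 → M.CondI re lam ω η k ∨ M.CondIII re ω k) ∧
      (lam = 0 → M.CondI re lam ω η k ∨ M.CondII re ω k) ∧
      (lam = 0 ∧ η = 0 → M.Q = -2 * ω * re) := by
  obtain ⟨η, hη⟩ := KNAdS.exists_separationConstant hre hform hsol hnontrivial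
  have hsep := (hη η).2 rfl
  have him := KNAdS.separationConstant_im_eq_zero hre hform haxis hnontrivial hsep.2
  have hηr : η = (η.re : ℂ) := Complex.ext rfl (by simpa using him)
  rw [hηr] at hη hsep
  have hI := KNAdS.condI_of_memLpSlice hre hform hsol hnontrivial hp hp' hLp hsep.1
  have hK := KNAdS.radialK_horizon_eq_zero hre hform hsol hnontrivial hp hp' hLp hsep.1
  -- Condition (i) answers all three disjunctions; only the value of `Q` remains.
  refine ⟨η.re, hη, Or.inl hI, fun _ => Or.inl hI, fun _ => Or.inl hI, ?_⟩
  rintro ⟨rfl, h0⟩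
  have hr := hre.1.ne'
  rw [h0, KNAdS.CondI] at hI
  have hz : M.zeta3 re ω k = 0 := by
    have : M.zeta3 re ω k ^ 2 ≤ 0 := by linarith
    exact pow_eq_zero_iff two_ne_zero |>.1 (le_antisymm this (sq_nonneg _))
  unfold KNAdS.zeta3 at hz
  unfold KNAdS.radialK at hK
  field_simp at hz
  refine mul_right_cancel₀ hr ?_
  -- `ζ₃ = 0` makes the constant term of `K` equal to `ω re²`, so `K(re) = 0` becomes `2ω re² + Q re
  -- = 0`; the factor `re` has just been cancelled from the goal.
  linear_combination hK + hz / 2
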